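/- Let $A$ be a finite alphabet. Regular expressions with complement over $A$ are built from $\emptyset$, $\epsilon$ and the letters $a\in A$ by concatenation, union, Kleene star and complement, with the usual languages and $L(\overline{R})=A^*\setminus L(R)$. Fix countably many string variables, ranging over $A^*$, and integer variables, ranging over $\mathbb{Z}$. Formulae of $\mathcal{A}_{elc}$ are Boolean combinations of atoms $\alpha\mathrel{\dot\in}R$, $s\le t$ and $s=t$, where $\alpha$ is a string term, i.e. a finite word over letters and string variables, $R$ is a regular expression with complement, and $s,t$ are linear integer terms, built from integer constants, integer variables and lengths $\mathsf{len}(\beta)$ of string terms $\beta$ by addition and multiplication by integer constants. Formulae of $\mathcal{A}_{el}$ are defined in the same way, except that a string term is only a single string variable or a constant word in $A^*$. A formula is satisfiable if some assignment of words to the string variables and of integers to the integer variables makes it true, where $\alpha\mathrel{\dot\in}R$ means that the value of $\alpha$ lies in $L(R)$ and $\mathsf{len}(\beta)$ is the length of the value of $\beta$. Then the satisfiability problem for $\mathcal{A}_{elc}$ and the satisfiability problem for $\mathcal{A}_{el}$ are both decidable: for each there is an algorithm that, given a formula, decides whether it is satisfiable. -/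

import Mathlib

open Encodable

namespace StrArith

/-! ### Finite syntax trees and their coding by natural numbers

`Syn L U B` is the type of finite trees with leaves labelled by `L`, unary nodes labelled by `U` and
binary nodes labelled by `B`.  Its only purpose is to give the syntax below an explicit
effective Goedel numbering (a `Primcodable` instance), so that `ComputablePred` makes sense. -/

inductive Syn (L U B : Type*) where
  | leaf : L → Syn L U B
  | un : U → Syn L U B → Syn L U B
  | bin : B → Syn L U B → Syn L U B → Syn L U B

namespace Syn

variable {L U B : Type*} [Primcodable L] [Primcodable U] [Primcodable B]

/-- The code of a tree. -/
def toNat : Syn L U B → ℕ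
  | leaf l => Nat.pair 0 (encode l)
  | un u t => Nat.pair 1 (Nat.pair (encode u) (toNat t))
  | bin b s t => Nat.pair 2 (Nat.pair (encode b) (Nat.pair (toNat s) (toNat t)))

theorem unpair_snd_lt {n : ℕ} (h : n.unpair.1 ≠ 0) : n.unpair.2 < n := by
  have := Nat.add_le_pair n.unpair.1 n.unpair.2
  rw [Nat.pair_unpair] at this
  omega

theorem arg1_lt {n : ℕ} (h : n.unpair.1 ≠ 0) : n.unpair.2.unpair.2 < n :=
  (Nat.unpair_right_le _).trans_lt (unpair_snd_lt h)

theorem arg2_lt {n : ℕ} (h : n.unpair.1 ≠ 0) : n.unpair.2.unpair.2.unpair.1 < n :=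
  (Nat.unpair_left_le _).trans_lt (arg1_lt h)

theorem arg3_lt {n : ℕ} (h : n.unpair.1 ≠ 0) : n.unpair.2.unpair.2.unpair.2 < n :=
  (Nat.unpair_right_le _).trans_lt (arg1_lt h)

/-- The tree with a given code, if there is one. -/
def ofNat? (n : ℕ) : Option (Syn L U B) :=
  if h0 : n.unpair.1 = 0 then (decode n.unpair.2 : Option L).map leaf
  else if n.unpair.1 = 1 then
    (decode n.unpair.2.unpair.1 : Option U).bind fun u =>
      (ofNat? n.unpair.2.unpair.2).map fun t => un u t
  else if n.unpair.1 = 2 then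
    (decode n.unpair.2.unpair.1 : Option B).bind fun b =>
      (ofNat? n.unpair.2.unpair.2.unpair.1).bind fun s =>
        (ofNat? n.unpair.2.unpair.2.unpair.2).map fun t => bin b s t
  else none
termination_by n
decreasing_by
  · exact arg1_lt h0
  · exact arg2_lt h0
  · exact arg3_lt h0

theorem ofNat?_toNat (t : Syn L U B) : ofNat? (toNat t) = some t := by
  induction t with
  | leaf l => rw [ofNat?]; simp [toNat]
  | un u t ih => rw [ofNat?]; simp [toNat, ih]
  | bin b s t ihs iht => rw [ofNat?]; simp [toNat, ihs, iht]

instance : Encodable (Syn L U B) := ⟨toNat, ofNat?, ofNat?_toNat⟩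

theorem encode_ofNat? (n : ℕ) : encode (ofNat? n : Option (Syn L U B)) =
    (ofNat? n : Option (Syn L U B)).elim 0 (fun t => toNat t + 1) := by
  cases (ofNat? n : Option (Syn L U B)) <;> rfl

/-- One step of the course-of-values recursion that computes the code of `ofNat? n` from the
list of the codes of `ofNat? m` for `m < n`. -/
def step (L U B : Type*) [Primcodable L] [Primcodable U] [Primcodable B]
    (l : List (Option ℕ)) : Option (Option ℕ) :=
  some <|
  if l.length.unpair.1 = 0 then
    (decode l.length.unpair.2 : Option L).map fun x => Nat.pair 0 (encode x)
  else if l.length.unpair.1 = 1 then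
    (decode l.length.unpair.2.unpair.1 : Option U).bind fun u =>
      (l[l.length.unpair.2.unpair.2]?.getD none).map fun t =>
        Nat.pair 1 (Nat.pair (encode u) t)
  else if l.length.unpair.1 = 2 then
    (decode l.length.unpair.2.unpair.1 : Option B).bind fun b =>
      (l[l.length.unpair.2.unpair.2.unpair.1]?.getD none).bind fun s =>
        (l[l.length.unpair.2.unpair.2.unpair.2]?.getD none).map fun t =>
          Nat.pair 2 (Nat.pair (encode b) (Nat.pair s t))
  else none

theorem step_primrec : Primrec (step L U B) := by
  have hlen : Primrec fun l : List (Option ℕ) => l.length.unpair :=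
    Primrec.unpair.comp Primrec.list_length
  have h1 := Primrec.fst.comp hlen
  have h2 := Primrec.snd.comp hlen
  have h21 := Primrec.fst.comp (Primrec.unpair.comp h2)
  have h22 := Primrec.snd.comp (Primrec.unpair.comp h2)
  have h221 := Primrec.fst.comp (Primrec.unpair.comp h22)
  have h222 := Primrec.snd.comp (Primrec.unpair.comp h22)
  have get {f : List (Option ℕ) → ℕ} (hf : Primrec f) :
      Primrec fun l : List (Option ℕ) => (l[f l]?.getD none : Option ℕ) :=
    Primrec.option_getD.comp (Primrec.list_getElem?.comp Primrec.id hf) (Primrec.const none)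
  refine Primrec.option_some.comp
    (Primrec.ite (Primrec.eq.comp h1 (Primrec.const 0)) ?_
      (Primrec.ite (Primrec.eq.comp h1 (Primrec.const 1)) ?_
        (Primrec.ite (Primrec.eq.comp h1 (Primrec.const 2)) ?_ (Primrec.const none))))
  · exact Primrec.option_map (Primrec.decode.comp h2)
      (Primrec₂.natPair.comp (Primrec.const 0) (Primrec.encode.comp Primrec.snd)).to₂
  · have k : Primrec fun p : List (Option ℕ) × U =>
        (p.1[p.1.length.unpair.2.unpair.2]?.getD none).map fun t =>
          Nat.pair 1 (Nat.pair (encode p.2) t) :=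
      Primrec.option_map ((get h22).comp Primrec.fst)
        (Primrec₂.natPair.comp (Primrec.const 1)
          (Primrec₂.natPair.comp (Primrec.encode.comp (Primrec.snd.comp Primrec.fst))
            Primrec.snd)).to₂
    exact Primrec.option_bind (Primrec.decode.comp h21) k
  · have k' : Primrec fun p : (List (Option ℕ) × B) × ℕ =>
        (p.1.1[p.1.1.length.unpair.2.unpair.2.unpair.2]?.getD none).map fun t =>
          Nat.pair 2 (Nat.pair (encode p.1.2) (Nat.pair p.2 t)) :=
      Primrec.option_map ((get h222).comp (Primrec.fst.comp Primrec.fst))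
        (Primrec₂.natPair.comp (Primrec.const 2)
          (Primrec₂.natPair.comp
            (Primrec.encode.comp (Primrec.snd.comp (Primrec.fst.comp Primrec.fst)))
            (Primrec₂.natPair.comp (Primrec.snd.comp Primrec.fst) Primrec.snd))).to₂
    have k : Primrec fun p : List (Option ℕ) × B =>
        (p.1[p.1.length.unpair.2.unpair.2.unpair.1]?.getD none).bind fun s =>
          (p.1[p.1.length.unpair.2.unpair.2.unpair.2]?.getD none).map fun t =>
            Nat.pair 2 (Nat.pair (encode p.2) (Nat.pair s t)) :=
      Primrec.option_bind ((get h221).comp Primrec.fst) k'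
    exact Primrec.option_bind (Primrec.decode.comp h21) k

theorem step_spec (n : ℕ) :
    step L U B ((List.range n).map fun m => (ofNat? m : Option (Syn L U B)).map toNat) =
      some ((ofNat? n : Option (Syn L U B)).map toNat) := by
  have get {m : ℕ} (hm : m < n) :
      ((((List.range n).map fun m => (ofNat? m : Option (Syn L U B)).map toNat)[m]?).getD none :
        Option ℕ) = (ofNat? m : Option (Syn L U B)).map toNat := by
    simp [hm]
  unfold step
  simp only [List.length_map, List.length_range, Option.some.injEq]
  conv_rhs => rw [ofNat?]
  by_cases h0 : n.unpair.1 = 0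
  · simp only [h0, if_true, dif_pos]
    cases (decode n.unpair.2 : Option L) <;> simp [toNat]
  · rw [get (arg1_lt h0), get (arg2_lt h0), get (arg3_lt h0)]
    simp only [h0, if_false, dite_false]
    split_ifs
    · cases (decode n.unpair.2.unpair.1 : Option U) <;>
        cases (ofNat? n.unpair.2.unpair.2 : Option (Syn L U B)) <;> simp [toNat]
    · cases (decode n.unpair.2.unpair.1 : Option B) <;>
        cases (ofNat? n.unpair.2.unpair.2.unpair.1 : Option (Syn L U B)) <;>
        cases (ofNat? n.unpair.2.unpair.2.unpair.2 : Option (Syn L U B)) <;> simp [toNat]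
    · rfl

instance : Primcodable (Syn L U B) where
  prim := by
    have h : Primrec₂ fun (_ : Unit) (n : ℕ) => (ofNat? n : Option (Syn L U B)).map toNat :=
      Primrec.nat_strong_rec _ (step_primrec (L := L) (U := U) (B := B).comp Primrec.snd).to₂
        fun _ n => step_spec n
    have h' : Primrec fun n : ℕ => (ofNat? n : Option (Syn L U B)).map toNat :=
      h.comp (Primrec.const ()) Primrec.id
    refine (Primrec.nat_iff.1 (Primrec.encode.comp h')).of_eq fun n => ?_
    change encode ((ofNat? n : Option (Syn L U B)).map toNat) =
      encode (ofNat? n : Option (Syn L U B))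
    rw [encode_ofNat?]
    cases (ofNat? n : Option (Syn L U B)) <;> rfl

end Syn

/-! ### Regular expressions with complement -/

/-- Regular expressions with complement over the alphabet `A`. -/
inductive Regex (A : Type*) where
  | empty : Regex A
  | epsilon : Regex A
  | letter : A → Regex A
  | concat : Regex A → Regex A → Regex A
  | union : Regex A → Regex A → Regex A
  | star : Regex A → Regex A
  | compl : Regex A → Regex A

namespace Regex

variable {A : Type*}

/-- The language of a regular expression; the complement is taken in the set of all words. -/
def lang : Regex A → Language A
  | empty => 0
  | epsilon => 1
  | letter a => {[a]}
  | concat R S => R.lang * S.lang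
  | union R S => R.lang + S.lang
  | star R => KStar.kstar R.lang
  | compl R => R.langᶜ

/-- Expressions as syntax trees: leaves are empty set, empty word and letters, unary nodes are
star (`false`) and complement (`true`), binary nodes are concatenation (`false`) and union
(`true`). -/
def toSyn : Regex A → Syn (Option (Option A)) Bool Bool
  | empty => .leaf none
  | epsilon => .leaf (some none)
  | letter a => .leaf (some (some a))
  | concat R S => .bin false R.toSyn S.toSyn
  | union R S => .bin true R.toSyn S.toSyn
  | star R => .un false R.toSyn
  | compl R => .un true R.toSyn

/-- Inverse of `toSyn`. -/
def ofSyn : Syn (Option (Option A)) Bool Bool → Regex A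
  | .leaf none => empty
  | .leaf (some none) => epsilon
  | .leaf (some (some a)) => letter a
  | .bin false R S => concat (ofSyn R) (ofSyn S)
  | .bin true R S => union (ofSyn R) (ofSyn S)
  | .un false R => star (ofSyn R)
  | .un true R => compl (ofSyn R)

/-- Expressions correspond to their syntax trees. -/
def equivSyn : Regex A ≃ Syn (Option (Option A)) Bool Bool where
  toFun := toSyn
  invFun := ofSyn
  left_inv R := by induction R <;> simp_all [toSyn, ofSyn]
  right_inv t := by
    induction t with
    | leaf l => rcases l with _ | _ | a <;> rfl
    | un u t ih => cases u <;> simp_all [toSyn, ofSyn]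
    | bin b s t ihs iht => cases b <;> simp_all [toSyn, ofSyn]

instance [Primcodable A] : Primcodable (Regex A) := Primcodable.ofEquiv _ equivSyn

end Regex

/-! ### String terms -/

/-- String terms of the theory with concatenation: words over letters and
string variables (the `i`-th variable is `Sum.inr i`). -/
abbrev Pattern (A : Type*) := List (A ⊕ ℕ)

/-- String terms of the theory without concatenation: constant words and single variables. -/
abbrev SimpleTerm (A : Type*) := List A ⊕ ℕ

/-- The value of a pattern: the morphism extending the assignment `h`, identity on letters. -/
def Pattern.eval {A : Type*} (h : ℕ → List A) (α : Pattern A) : List A :=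
  α.flatMap (Sum.elim (fun a => [a]) h)

/-- The value of a simple string term. -/
def SimpleTerm.eval {A : Type*} (h : ℕ → List A) : SimpleTerm A → List A :=
  Sum.elim id h

/-! ### Linear integer terms -/

/-- Linear integer terms, where `T` is the type of string terms. -/
inductive IntTerm (T : Type*) where
  | const : ℤ → IntTerm T
  | var : ℕ → IntTerm T
  | len : T → IntTerm T
  | add : IntTerm T → IntTerm T → IntTerm T
  | smul : ℤ → IntTerm T → IntTerm T

namespace IntTerm

variable {T : Type*}

/-- The value of an integer term; `ev` gives the values of the string terms and `g` those of the
integer variables. -/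
def eval {A : Type*} (ev : T → List A) (g : ℕ → ℤ) : IntTerm T → ℤ
  | const c => c
  | var i => g i
  | len α => (ev α).length
  | add s t => s.eval ev g + t.eval ev g
  | smul c t => c * t.eval ev g

/-- Integer terms as syntax trees. -/
def toSyn : IntTerm T → Syn (ℤ ⊕ ℕ ⊕ T) ℤ Unit
  | const c => .leaf (.inl c)
  | var i => .leaf (.inr (.inl i))
  | len α => .leaf (.inr (.inr α))
  | add s t => .bin () s.toSyn t.toSyn
  | smul c t => .un c t.toSyn

/-- Inverse of `toSyn`. -/
def ofSyn : Syn (ℤ ⊕ ℕ ⊕ T) ℤ Unit → IntTerm T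
  | .leaf (.inl c) => const c
  | .leaf (.inr (.inl i)) => var i
  | .leaf (.inr (.inr α)) => len α
  | .bin () s t => add (ofSyn s) (ofSyn t)
  | .un c t => smul c (ofSyn t)

/-- Integer terms correspond to their syntax trees. -/
def equivSyn : IntTerm T ≃ Syn (ℤ ⊕ ℕ ⊕ T) ℤ Unit where
  toFun := toSyn
  invFun := ofSyn
  left_inv t := by induction t <;> simp_all [toSyn, ofSyn]
  right_inv t := by
    induction t with
    | leaf l => rcases l with _ | _ | a <;> rfl
    | un u t ih => simp_all [toSyn, ofSyn]
    | bin b s t ihs iht => simp_all [toSyn, ofSyn]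

instance [Primcodable T] : Primcodable (IntTerm T) := Primcodable.ofEquiv _ equivSyn

end IntTerm

/-! ### Quantifier-free formulae -/

/-- Quantifier-free formulae over string terms `T`: Boolean combinations of regular membership
atoms and of linear integer (in)equalities. -/
inductive Formula (A T : Type*) where
  | mem : T → Regex A → Formula A T
  | le : IntTerm T → IntTerm T → Formula A T
  | eq : IntTerm T → IntTerm T → Formula A T
  | not : Formula A T → Formula A T
  | and : Formula A T → Formula A T → Formula A T
  | or : Formula A T → Formula A T → Formula A T

namespace Formula

variable {A T : Type*}

/-- Truth of a formula, where `ev` gives the values of the string terms and `g` those of the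
integer variables. -/
def Holds (ev : T → List A) (g : ℕ → ℤ) : Formula A T → Prop
  | mem α R => ev α ∈ R.lang
  | le s t => s.eval ev g ≤ t.eval ev g
  | eq s t => s.eval ev g = t.eval ev g
  | not φ => ¬ φ.Holds ev g
  | and φ ψ => φ.Holds ev g ∧ ψ.Holds ev g
  | or φ ψ => φ.Holds ev g ∨ ψ.Holds ev g

/-- The atoms. -/
abbrev Atom (A T : Type*) := (T × Regex A) ⊕ (IntTerm T × IntTerm T) ⊕ (IntTerm T × IntTerm T)

/-- Formulae as syntax trees. -/
def toSyn : Formula A T → Syn (Atom A T) Unit Bool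
  | mem α R => .leaf (.inl (α, R))
  | le s t => .leaf (.inr (.inl (s, t)))
  | eq s t => .leaf (.inr (.inr (s, t)))
  | not φ => .un () φ.toSyn
  | and φ ψ => .bin false φ.toSyn ψ.toSyn
  | or φ ψ => .bin true φ.toSyn ψ.toSyn

/-- Inverse of `toSyn`. -/
def ofSyn : Syn (Atom A T) Unit Bool → Formula A T
  | .leaf (.inl (α, R)) => mem α R
  | .leaf (.inr (.inl (s, t))) => le s t
  | .leaf (.inr (.inr (s, t))) => eq s t
  | .un () φ => not (ofSyn φ)
  | .bin false φ ψ => and (ofSyn φ) (ofSyn ψ)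
  | .bin true φ ψ => or (ofSyn φ) (ofSyn ψ)

/-- Formulae correspond to their syntax trees. -/
def equivSyn : Formula A T ≃ Syn (Atom A T) Unit Bool where
  toFun := toSyn
  invFun := ofSyn
  left_inv t := by induction t <;> simp_all [toSyn, ofSyn]
  right_inv t := by
    induction t with
    | leaf l => rcases l with _ | _ | _ <;> rfl
    | un u t ih => simp_all [toSyn, ofSyn]
    | bin b s t ihs iht => cases b <;> simp_all [toSyn, ofSyn]

instance [Primcodable A] [Primcodable T] : Primcodable (Formula A T) :=
  Primcodable.ofEquiv _ equivSyn

end Formula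

/-- Formulae of the theory with complement, length and concatenation. -/
abbrev FormulaELC (A : Type*) := Formula A (Pattern A)

/-- Formulae of the theory with complement and length, without concatenation of string terms. -/
abbrev FormulaEL (A : Type*) := Formula A (SimpleTerm A)

/-- Satisfiability: some assignment of words to the string variables and of integers to the
integer variables makes the formula true. -/
def FormulaELC.Satisfiable {A : Type*} (φ : FormulaELC A) : Prop :=
  ∃ (h : ℕ → List A) (g : ℕ → ℤ), φ.Holds (Pattern.eval h) g

/-- Satisfiability, as above, for formulae without concatenation of string terms. -/
def FormulaEL.Satisfiable {A : Type*} (φ : FormulaEL A) : Prop :=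
  ∃ (h : ℕ → List A) (g : ℕ → ℤ), φ.Holds (SimpleTerm.eval h) g

end StrArith

/-! Satisfiability has an effective small model property. A formula with code `n` that is
satisfiable has a satisfying assignment whose code is at most a primitive recursive function of `n`,
and truth under a given finite assignment is primitive recursive. A bounded search therefore decides
satisfiability.

For the bound, words are considered up to `Twin n`: equal behaviour in all contexts with respect to
every expression of code at most `n`. A language denoted by an expression with complement has
finitely many left quotients, at most a tower of exponentials in the code (`Regex.hasIndexLE_lang`),
so there are finitely many twin classes. Twins are preserved by concatenation, so replacing the
values of variables by twins keeps the truth of every membership atom, also for terms with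
concatenation; no elimination of concatenation is needed. By pigeonhole on the sets of classes
realised at each length, the lengths available for twins are eventually periodic: the twins of a
word include words of all lengths `r + q * y'` with bounded `r` and `q` (`exists_twins_of_lengths`).

Lengths thus become linear in natural unknowns `y`, and integers become a sign times a natural
number. The arithmetic atoms turn into linear inequalities with bounded coefficients, and all of
these together keep their truth values when the unknowns are replaced by small ones
(`exists_small_solution`). This is proved by deleting a block of binary digits between two positions
with equal carries. `Formula.exists_bounded_assignment` combines the two reductions. Both theories
are treated at once by interpreting string terms as patterns through a map `pat`. -/

namespace StrArith

/-! ### Primitive recursion over syntax trees. -/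

namespace Syn

variable {L U B : Type*}

/-- Structural recursion on trees. -/
def fold {σ : Type*} (f : L → σ) (g : U → σ → σ) (k : B → σ → σ → σ) : Syn L U B → σ
  | leaf l => f l
  | un u t => g u (fold f g k t)
  | bin b s t => k b (fold f g k s) (fold f g k t)

variable [Primcodable L] [Primcodable U] [Primcodable B]

/-- Course-of-values recursion on codes works because subtrees have smaller codes. The evaluations
of expressions, integer terms and formulae below are rewritten as folds so that this applies; the
parameter `P` carries the assignment or the length bound. -/
theorem primrec_fold {P σ : Type*} [Primcodable P] [Primcodable σ]
    {f : P → L → σ} {g : P → U × σ → σ} {k : P → B × σ × σ → σ} {t : P → Syn L U B}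
    (hf : Primrec₂ f) (hg : Primrec₂ g) (hk : Primrec₂ k) (ht : Primrec t) :
    Primrec fun p =>
      fold (f p) (fun u x => g p (u, x)) (fun b x y => k p (b, x, y)) (t p) := by
  let fd (p : P) : Syn L U B → σ :=
    fold (f p) (fun u x => g p (u, x)) (fun b x y => k p (b, x, y))
  let F (p : P) (n : ℕ) : Option σ := (ofNat? n : Option (Syn L U B)).map (fd p)
  let G (p : P) (l : List (Option σ)) : Option (Option σ) :=
    some <|
    if l.length.unpair.1 = 0 then
      (decode l.length.unpair.2 : Option L).map fun x => f p x
    else if l.length.unpair.1 = 1 then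
      (decode l.length.unpair.2.unpair.1 : Option U).bind fun u =>
        (l[l.length.unpair.2.unpair.2]?.getD none).map fun t => g p (u, t)
    else if l.length.unpair.1 = 2 then
      (decode l.length.unpair.2.unpair.1 : Option B).bind fun b =>
        (l[l.length.unpair.2.unpair.2.unpair.1]?.getD none).bind fun s =>
          (l[l.length.unpair.2.unpair.2.unpair.2]?.getD none).map fun t => k p (b, s, t)
    else none
  have hG : Primrec₂ G := by
    have hlen : Primrec fun q : P × List (Option σ) => q.2.length.unpair :=
      Primrec.unpair.comp (Primrec.list_length.comp Primrec.snd)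
    have h1 := Primrec.fst.comp hlen
    have h2 := Primrec.snd.comp hlen
    have h21 := Primrec.fst.comp (Primrec.unpair.comp h2)
    have h22 := Primrec.snd.comp (Primrec.unpair.comp h2)
    have h221 := Primrec.fst.comp (Primrec.unpair.comp h22)
    have h222 := Primrec.snd.comp (Primrec.unpair.comp h22)
    have get {e : P × List (Option σ) → ℕ} (he : Primrec e) :
        Primrec fun q : P × List (Option σ) => (q.2[e q]?.getD none : Option σ) :=
      Primrec.option_getD.comp (Primrec.list_getElem?.comp Primrec.snd he) (Primrec.const none)
    refine Primrec.option_some.comp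
      (Primrec.ite (Primrec.eq.comp h1 (Primrec.const 0)) ?_
        (Primrec.ite (Primrec.eq.comp h1 (Primrec.const 1)) ?_
          (Primrec.ite (Primrec.eq.comp h1 (Primrec.const 2)) ?_ (Primrec.const none))))
    · exact Primrec.option_map (Primrec.decode.comp h2)
        (hf.comp (Primrec.fst.comp Primrec.fst) Primrec.snd).to₂
    · have k1 : Primrec fun q : (P × List (Option σ)) × U =>
          (q.1.2[q.1.2.length.unpair.2.unpair.2]?.getD none).map fun t => g q.1.1 (q.2, t) :=
        Primrec.option_map ((get h22).comp Primrec.fst)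
          (hg.comp (Primrec.fst.comp (Primrec.fst.comp Primrec.fst))
            ((Primrec.snd.comp Primrec.fst).pair Primrec.snd)).to₂
      exact Primrec.option_bind (Primrec.decode.comp h21) k1
    · have k2 : Primrec fun q : ((P × List (Option σ)) × B) × σ =>
          (q.1.1.2[q.1.1.2.length.unpair.2.unpair.2.unpair.2]?.getD none).map fun t =>
            k q.1.1.1 (q.1.2, q.2, t) :=
        Primrec.option_map ((get h222).comp (Primrec.fst.comp Primrec.fst))
          (hk.comp (Primrec.fst.comp (Primrec.fst.comp (Primrec.fst.comp Primrec.fst)))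
            ((Primrec.snd.comp (Primrec.fst.comp Primrec.fst)).pair
              ((Primrec.snd.comp Primrec.fst).pair Primrec.snd))).to₂
      have k1 : Primrec fun q : (P × List (Option σ)) × B =>
          (q.1.2[q.1.2.length.unpair.2.unpair.2.unpair.1]?.getD none).bind fun s =>
            (q.1.2[q.1.2.length.unpair.2.unpair.2.unpair.2]?.getD none).map fun t =>
              k q.1.1 (q.2, s, t) :=
        Primrec.option_bind ((get h221).comp Primrec.fst) k2
      exact Primrec.option_bind (Primrec.decode.comp h21) k1
  have hstep (p : P) (n : ℕ) : G p ((List.range n).map (F p)) = some (F p n) := by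
    have get {m : ℕ} (hm : m < n) :
        ((((List.range n).map (F p))[m]?).getD none : Option σ) = F p m := by
      simp [hm]
    simp only [G, List.length_map, List.length_range, Option.some.injEq]
    by_cases h0 : n.unpair.1 = 0
    · simp only [F, h0, if_true]
      rw [ofNat?]
      simp only [h0, dif_pos]
      cases (decode n.unpair.2 : Option L) <;> simp [fd, fold]
    · rw [get (arg1_lt h0), get (arg2_lt h0), get (arg3_lt h0)]
      simp only [F]
      conv_rhs => rw [ofNat?]
      simp only [h0, if_false, dite_false]
      split_ifs
      · cases (decode n.unpair.2.unpair.1 : Option U) <;>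
          cases (ofNat? n.unpair.2.unpair.2 : Option (Syn L U B)) <;> simp [fd, fold]
      · cases (decode n.unpair.2.unpair.1 : Option B) <;>
          cases (ofNat? n.unpair.2.unpair.2.unpair.1 : Option (Syn L U B)) <;>
          cases (ofNat? n.unpair.2.unpair.2.unpair.2 : Option (Syn L U B)) <;> simp [fd, fold]
      · rfl
  have hF : Primrec₂ F := Primrec.nat_strong_rec F hG hstep
  refine Primrec.option_some_iff.1
    ((hF.comp Primrec.id (Primrec.encode.comp ht)).of_eq fun p => ?_)
  change (ofNat? (toNat (t p)) : Option (Syn L U B)).map (fd p) = _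
  rw [ofNat?_toNat]
  rfl

end Syn

/-! ### Deciding membership of a word in the language of an expression. -/

section Words

variable {A : Type*}

/-- All words of length at most `N` over the letters in `l`. -/
def wordsUpTo (l : List A) : ℕ → List (List A)
  | 0 => [[]]
  | N + 1 => [] :: (wordsUpTo l N).flatMap fun w => l.map fun a => a :: w

theorem mem_wordsUpTo {l : List A} (hl : ∀ a, a ∈ l) {N : ℕ} {w : List A} :
    w ∈ wordsUpTo l N ↔ w.length ≤ N := by
  induction N generalizing w with
  | zero => simp [wordsUpTo]
  | succ N ih =>
    cases w with
    | nil => simp [wordsUpTo]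
    | cons a w => simp [wordsUpTo, ih, hl]

theorem primrec_wordsUpTo [Primcodable A] (l : List A) : Primrec (wordsUpTo l) := by
  have h : Primrec fun N : ℕ => Nat.rec (motive := fun _ => List (List A)) [[]]
      (fun _ W => [] :: W.flatMap fun w => l.map fun a => a :: w) N := by
    refine Primrec.nat_rec₁ _ (Primrec.to₂ (f := fun q : ℕ × List (List A) =>
      [] :: q.2.flatMap fun w => l.map fun a => a :: w) ?_)
    refine Primrec.list_cons.comp (Primrec.const _) (Primrec.list_flatMap Primrec.snd ?_)
    exact (Primrec.list_map (Primrec.const l)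
      (Primrec.list_cons.comp Primrec.snd (Primrec.snd.comp Primrec.fst)).to₂).to₂
  refine h.of_eq fun N => ?_
  induction N with
  | zero => rfl
  | succ N ih => simp only [wordsUpTo, ← ih]

variable [DecidableEq A]

/-- The words of `W` that are products of a word of `X` and a word of `Y`. -/
def mulIn (W X Y : List (List A)) : List (List A) :=
  (X.flatMap fun x => Y.map fun y => x ++ y).filter fun w => w ∈ W

theorem mem_mulIn {W X Y : List (List A)} {w : List A} :
    w ∈ mulIn W X Y ↔ w ∈ W ∧ ∃ x ∈ X, ∃ y ∈ Y, x ++ y = w := by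
  simp [mulIn, and_comm]

/-- The words of `W` in the star of `X`, for large enough fuel. -/
def starIn (W X : List (List A)) : ℕ → List (List A)
  | 0 => [[]]
  | n + 1 => [] :: mulIn W X (starIn W X n)

variable [Primcodable A]

theorem primrec_mem {T : Type*} [Primcodable T] [DecidableEq T] :
    PrimrecRel fun (x : T) (l : List T) => x ∈ l :=
  ((Primrec.eq (α := T)).exists_mem_list.comp Primrec.snd Primrec.fst).of_eq fun p => by simp

theorem primrec_filter_mem {P T : Type*} [Primcodable P] [Primcodable T] [DecidableEq T]
    {X Y : P → List T} (hX : Primrec X) (hY : Primrec Y) :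
    Primrec fun p => (X p).filter fun w => w ∈ Y p :=
  (PrimrecRel.listFilter (primrec_mem (T := T))).comp hX hY

theorem primrec_mulIn {P : Type*} [Primcodable P] {W X Y : P → List (List A)}
    (hW : Primrec W) (hX : Primrec X) (hY : Primrec Y) :
    Primrec fun p => mulIn (W p) (X p) (Y p) := by
  refine (primrec_filter_mem (X := fun p => (X p).flatMap fun x => (Y p).map fun y => x ++ y)
    (Primrec.list_flatMap hX ?_) hW).of_eq fun p =>
    List.filter_congr fun _ _ => decide_eq_decide.2 Iff.rfl
  exact (Primrec.list_map (hY.comp Primrec.fst)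
    (Primrec.list_append.comp (Primrec.snd.comp Primrec.fst) Primrec.snd).to₂).to₂

theorem primrec_starIn {P : Type*} [Primcodable P] {W X : P → List (List A)} {n : P → ℕ}
    (hW : Primrec W) (hX : Primrec X) (hn : Primrec n) :
    Primrec fun p => starIn (W p) (X p) (n p) := by
  have h := Primrec.nat_rec' (f := n) (g := fun _ : P => ([[]] : List (List A)))
    (h := fun p q => [] :: mulIn (W p) (X p) q.2) hn (Primrec.const _)
    (Primrec.list_cons.comp (Primrec.const _)
      (primrec_mulIn (hW.comp Primrec.fst) (hX.comp Primrec.fst)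
        (Primrec.snd.comp Primrec.snd))).to₂
  refine h.of_eq fun p => ?_
  generalize n p = m
  induction m with
  | zero => rfl
  | succ m ih => simp only [starIn, ← ih]

end Words

namespace Regex

variable {A : Type*} [DecidableEq A]

/-- The list of the words of `W` in the language of an expression, provided that `W` is closed
under factors and `N` bounds the lengths of its members. -/
def wordsIn (W : List (List A)) (N : ℕ) : Regex A → List (List A)
  | empty => []
  | epsilon => [[]]
  | letter a => [[a]]
  | concat R S => mulIn W (wordsIn W N R) (wordsIn W N S)
  | union R S => wordsIn W N R ++ wordsIn W N S
  | star R => starIn W (wordsIn W N R) N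
  | compl R => W.filter fun w => w ∉ wordsIn W N R

/-- All factors of a word of length at most `N` are again that short, so concatenation, star and
complement can be computed inside the finite set of short words. Lists may contain a longer word,
such as `[a]` for `N = 0`; the bound on `w` makes this harmless. -/
theorem mem_wordsIn {l : List A} (hl : ∀ a, a ∈ l) {N : ℕ} (R : Regex A) {w : List A}
    (hw : w.length ≤ N) : w ∈ wordsIn (wordsUpTo l N) N R ↔ w ∈ R.lang := by
  induction R generalizing w with
  | empty => simp [wordsIn, lang]
  | epsilon => simp [wordsIn, lang, Language.mem_one]
  | letter a =>
    simp only [wordsIn, lang, List.mem_singleton]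
    rfl
  | concat R S ihR ihS =>
    simp only [wordsIn, lang, mem_mulIn, mem_wordsUpTo hl, Language.mem_mul, hw, true_and]
    constructor
    · rintro ⟨x, hx, y, hy, rfl⟩
      rw [List.length_append] at hw
      exact ⟨x, (ihR (by omega)).1 hx, y, (ihS (by omega)).1 hy, rfl⟩
    · rintro ⟨x, hx, y, hy, rfl⟩
      rw [List.length_append] at hw
      exact ⟨x, (ihR (by omega)).2 hx, y, (ihS (by omega)).2 hy, rfl⟩
  | union R S ihR ihS => simp [wordsIn, lang, ihR hw, ihS hw, Language.mem_add]
  | compl R ih =>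
    simp only [wordsIn, lang, List.mem_filter, mem_wordsUpTo hl, hw, true_and, ih hw,
      decide_eq_true_eq]
    rfl
  | star R ih =>
    simp only [wordsIn, lang]
    have sound (n : ℕ) {v : List A} (hv : v.length ≤ N)
        (h : v ∈ starIn (wordsUpTo l N) (wordsIn (wordsUpTo l N) N R) n) :
        v ∈ KStar.kstar R.lang := by
      induction n generalizing v with
      | zero =>
        rw [starIn, List.mem_singleton] at h
        exact h ▸ Language.nil_mem_kstar _
      | succ n ihn =>
        simp only [starIn, List.mem_cons, mem_mulIn] at h
        obtain rfl | ⟨-, x, hx, y, hy, rfl⟩ := h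
        · exact Language.nil_mem_kstar _
        · rw [List.length_append] at hv
          rw [← Language.one_add_self_mul_kstar_eq_kstar]
          exact Or.inr ⟨x, (ih (by omega)).1 hx, y, ihn (by omega) hy, rfl⟩
    -- Empty factors can be dropped from a product in the star, so each round consumes at least one
    -- letter and as many rounds as letters suffice.
    have complete (n : ℕ) {v : List A} (hv : v.length ≤ N) (hn : v.length ≤ n)
        (h : v ∈ KStar.kstar R.lang) :
        v ∈ starIn (wordsUpTo l N) (wordsIn (wordsUpTo l N) N R) n := by
      induction n generalizing v with
      | zero => simpa [starIn] using hn
      | succ n ihn =>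
        obtain ⟨S, rfl, hS⟩ := Language.mem_kstar_iff_exists_nonempty.1 h
        rcases S with _ | ⟨x, S⟩
        · simp [starIn]
        · have hx := hS x (by simp)
          have hxl := List.length_pos_iff.2 hx.2
          rw [List.flatten_cons, List.length_append] at hv hn
          refine List.mem_cons_of_mem _ (mem_mulIn.2 ⟨(mem_wordsUpTo hl).2 ?_, x,
            (ih (by omega)).2 hx.1, S.flatten, ihn (by omega) (by omega) ?_, ?_⟩)
          · simpa using hv
          · exact Language.join_mem_kstar fun y hy => (hS y (by simp [hy])).1
          · simp
    exact ⟨sound N hw, complete N hw hw⟩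

theorem wordsIn_eq_fold (W : List (List A)) (N : ℕ) (R : Regex A) :
    wordsIn W N R = R.toSyn.fold
      (fun l => l.elim [] fun o => o.elim [[]] fun a => [[a]])
      (fun u X => bif u then W.filter fun w => w ∉ X else starIn W X N)
      (fun b X Y => bif b then X ++ Y else mulIn W X Y) := by
  induction R <;> simp_all [wordsIn, toSyn, Syn.fold]

variable [Primcodable A]

theorem primrec_wordsIn {P : Type*} [Primcodable P] {W : P → List (List A)} {N : P → ℕ}
    {R : P → Regex A} (hW : Primrec W) (hN : Primrec N) (hR : Primrec R) :
    Primrec fun p => wordsIn (W p) (N p) (R p) := by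
  refine (Syn.primrec_fold (t := fun p => (R p).toSyn)
    (f := fun (_ : P) (l : Option (Option A)) =>
      (l.elim [] fun o => o.elim [[]] fun a => [[a]] : List (List A)))
    (g := fun p (q : Bool × List (List A)) => bif q.1 then (W p).filter fun w => w ∉ q.2
      else starIn (W p) q.2 (N p))
    (k := fun p (q : Bool × List (List A) × List (List A)) => bif q.1 then q.2.1 ++ q.2.2
      else mulIn (W p) q.2.1 q.2.2) ?_ ?_ ?_ ?_).of_eq fun p => (wordsIn_eq_fold _ _ _).symm
  · have h1 : Primrec fun o : Option A => (o.elim [[]] fun a => [[a]] : List (List A)) := by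
      refine (Primrec.option_casesOn (f := fun _ => ([[]] : List (List A)))
        (g := fun _ (a : A) => [[a]]) Primrec.id (Primrec.const _)
        (Primrec.list_cons.comp (Primrec.list_cons.comp Primrec.snd (Primrec.const _))
          (Primrec.const _)).to₂).of_eq fun o => ?_
      cases o <;> rfl
    refine (Primrec.option_casesOn (f := fun _ => ([] : List (List A)))
      (g := fun _ o => (o.elim [[]] fun a => [[a]])) Primrec.snd (Primrec.const _)
      (h1.comp Primrec.snd).to₂).of_eq fun q => ?_
    rcases q.2 with _ | _ | a <;> rfl
  · refine Primrec.cond (Primrec.fst.comp Primrec.snd) ?_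
      (primrec_starIn (hW.comp Primrec.fst) (Primrec.snd.comp Primrec.snd) (hN.comp Primrec.fst))
    exact ((PrimrecRel.listFilter (primrec_mem (T := List A)).not).comp
      (hW.comp Primrec.fst) (Primrec.snd.comp Primrec.snd))
  · have h2 : Primrec fun q : P × Bool × List (List A) × List (List A) => q.2.2.1 :=
      Primrec.fst.comp (Primrec.snd.comp Primrec.snd)
    have h3 : Primrec fun q : P × Bool × List (List A) × List (List A) => q.2.2.2 :=
      Primrec.snd.comp (Primrec.snd.comp Primrec.snd)
    exact Primrec.cond (Primrec.fst.comp Primrec.snd) (Primrec.list_append.comp h2 h3)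
      (primrec_mulIn (hW.comp Primrec.fst) h2 h3)
  · exact (Primrec.of_equiv (e := equivSyn)).comp hR

end Regex


/-! ### Primitive recursive evaluation of integer terms. -/

theorem encode_natCast (n : ℕ) : encode (n : ℤ) = 2 * n := rfl

theorem encode_negSucc (n : ℕ) : encode (Int.negSucc n) = 2 * n + 1 := rfl

theorem natAbs_le_encode (z : ℤ) : z.natAbs ≤ encode z := by
  cases z with
  | ofNat n => exact (Nat.le_mul_of_pos_left n two_pos).trans_eq (encode_natCast n).symm
  | negSucc n => rw [encode_negSucc, Int.natAbs_negSucc]; omega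

theorem primrec_toNat : Primrec Int.toNat := by
  have h : Primrec fun z : ℤ => if encode z % 2 = 0 then encode z / 2 else 0 :=
    Primrec.ite (Primrec.eq.comp (Primrec.nat_mod.comp Primrec.encode (Primrec.const 2))
      (Primrec.const 0)) (Primrec.nat_div.comp Primrec.encode (Primrec.const 2)) (Primrec.const 0)
  refine h.of_eq fun z => ?_
  cases z with
  | ofNat n => simp [encode_natCast]
  | negSucc n => simp [encode_negSucc, Nat.add_mod]

theorem primrec_neg_toNat : Primrec fun z : ℤ => (-z).toNat := by
  have h : Primrec fun z : ℤ => if encode z % 2 = 0 then 0 else encode z / 2 + 1 :=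
    Primrec.ite (Primrec.eq.comp (Primrec.nat_mod.comp Primrec.encode (Primrec.const 2))
      (Primrec.const 0)) (Primrec.const 0)
      (Primrec.succ.comp (Primrec.nat_div.comp Primrec.encode (Primrec.const 2)))
  refine h.of_eq fun z => ?_
  cases z with
  | ofNat n => simp [encode_natCast]
  | negSucc n =>
    have h1 : (2 * n + 1) / 2 = n := by omega
    have h2 : (2 * n + 1) % 2 = 1 := by omega
    simp [encode_negSucc, h1, h2]

/-- Finite assignments: words for the string variables, and differences of natural numbers for the
integer variables.  All other variables have default values. -/
abbrev Assignment (A : Type*) := List (List A) × List (ℕ × ℕ)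

namespace Assignment

variable {A : Type*}

/-- The words of the string variables. -/
def word (s : Assignment A) (i : ℕ) : List A := s.1.getD i []

/-- The integers of the integer variables, as differences. -/
def diff (s : Assignment A) (i : ℕ) : ℕ × ℕ := s.2.getD i (0, 0)

/-- The integers of the integer variables. -/
def int (s : Assignment A) (i : ℕ) : ℤ := (s.diff i).1 - (s.diff i).2

variable [Primcodable A]

theorem primrec_word : Primrec₂ (word : Assignment A → ℕ → List A) :=
  (Primrec.list_getD []).comp (Primrec.fst.comp Primrec.fst) Primrec.snd

theorem primrec_diff : Primrec₂ (diff : Assignment A → ℕ → ℕ × ℕ) :=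
  (Primrec.list_getD (0, 0)).comp (Primrec.snd.comp Primrec.fst) Primrec.snd

theorem primrec_patternEval :
    Primrec₂ fun (s : Assignment A) (α : Pattern A) => Pattern.eval s.word α := by
  refine (Primrec.list_flatMap (f := fun q : Assignment A × Pattern A => q.2)
    (g := fun q x => Sum.casesOn x (fun a => [a]) q.1.word) Primrec.snd ?_).of_eq fun q => ?_
  · refine (Primrec.sumCasesOn Primrec.snd ?_ ?_)
    · exact (Primrec.list_cons.comp Primrec.snd (Primrec.const _))
    · exact (primrec_word.comp (Primrec.fst.comp (Primrec.fst.comp Primrec.fst)) Primrec.snd)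
  · unfold Pattern.eval
    congr 1

end Assignment

namespace IntTerm

variable {T : Type*}

/-- The value of an integer term as a difference of natural numbers. -/
def evalDiff (len' : T → ℕ) (d : ℕ → ℕ × ℕ) : IntTerm T → ℕ × ℕ
  | const c => (c.toNat, (-c).toNat)
  | var i => d i
  | len α => (len' α, 0)
  | add s t => ((s.evalDiff len' d).1 + (t.evalDiff len' d).1,
      (s.evalDiff len' d).2 + (t.evalDiff len' d).2)
  | smul c t =>
    (c.toNat * (t.evalDiff len' d).1 + (-c).toNat * (t.evalDiff len' d).2,
      c.toNat * (t.evalDiff len' d).2 + (-c).toNat * (t.evalDiff len' d).1)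

/-- Writing integers as differences keeps the evaluation within addition and multiplication of
natural numbers, whose primitive recursiveness is available. -/
theorem eval_eq_evalDiff {A : Type*} (ev : T → List A) (d : ℕ → ℕ × ℕ) (t : IntTerm T) :
    t.eval ev (fun i => (d i).1 - (d i).2) =
      (t.evalDiff (fun α => (ev α).length) d).1 - (t.evalDiff (fun α => (ev α).length) d).2 := by
  induction t with
  | const c => simp only [eval, evalDiff]; omega
  | var i => rfl
  | len α => simp [eval, evalDiff]
  | add s t ihs iht => simp only [eval, evalDiff, ihs, iht]; push_cast; ring
  | smul c t ih =>
    have hc : c = (c.toNat : ℤ) - ((-c).toNat : ℤ) := by omega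
    simp only [eval, evalDiff, ih]
    push_cast
    generalize (c.toNat : ℤ) = x at *
    generalize ((-c).toNat : ℤ) = y at *
    subst hc
    ring

theorem evalDiff_eq_fold (len' : T → ℕ) (d : ℕ → ℕ × ℕ) (t : IntTerm T) :
    t.evalDiff len' d = t.toSyn.fold
      (fun l => Sum.casesOn l (fun c => (c.toNat, (-c).toNat))
        fun r => Sum.casesOn r d fun α => (len' α, 0))
      (fun c x => (c.toNat * x.1 + (-c).toNat * x.2, c.toNat * x.2 + (-c).toNat * x.1))
      (fun _ x y => (x.1 + y.1, x.2 + y.2)) := by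
  induction t <;> simp_all [evalDiff, toSyn, Syn.fold]

variable [Primcodable T]

theorem primrec_evalDiff {P : Type*} [Primcodable P] {len' : P → T → ℕ} {d : P → ℕ → ℕ × ℕ}
    {t : P → IntTerm T} (hl : Primrec₂ len') (hd : Primrec₂ d) (ht : Primrec t) :
    Primrec fun p => (t p).evalDiff (len' p) (d p) := by
  refine (Syn.primrec_fold (t := fun p => (t p).toSyn)
    (f := fun p l => Sum.casesOn l (fun c => (c.toNat, (-c).toNat))
        fun r => Sum.casesOn r (d p) fun α => (len' p α, 0))
    (g := fun _ (q : ℤ × ℕ × ℕ) => (q.1.toNat * q.2.1 + (-q.1).toNat * q.2.2,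
      q.1.toNat * q.2.2 + (-q.1).toNat * q.2.1))
    (k := fun _ (q : Unit × (ℕ × ℕ) × ℕ × ℕ) => (q.2.1.1 + q.2.2.1, q.2.1.2 + q.2.2.2))
    ?_ ?_ ?_ ?_).of_eq fun p => (evalDiff_eq_fold _ _ _).symm
  · have h1 : Primrec fun q : P × (ℕ ⊕ T) =>
        (Sum.casesOn q.2 (d q.1) fun α => (len' q.1 α, 0) : ℕ × ℕ) :=
      Primrec.sumCasesOn Primrec.snd (hd.comp (Primrec.fst.comp Primrec.fst) Primrec.snd).to₂
        ((hl.comp (Primrec.fst.comp Primrec.fst) Primrec.snd).pair (Primrec.const 0)).to₂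
    exact Primrec.sumCasesOn Primrec.snd
      ((primrec_toNat.comp Primrec.snd).pair (primrec_neg_toNat.comp Primrec.snd)).to₂
      (h1.comp ((Primrec.fst.comp Primrec.fst).pair Primrec.snd)).to₂
  · have h1 : Primrec fun q : P × ℤ × ℕ × ℕ => q.2.1.toNat :=
      primrec_toNat.comp (Primrec.fst.comp Primrec.snd)
    have h2 : Primrec fun q : P × ℤ × ℕ × ℕ => (-q.2.1).toNat :=
      primrec_neg_toNat.comp (Primrec.fst.comp Primrec.snd)
    have h3 : Primrec fun q : P × ℤ × ℕ × ℕ => q.2.2.1 :=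
      Primrec.fst.comp (Primrec.snd.comp Primrec.snd)
    have h4 : Primrec fun q : P × ℤ × ℕ × ℕ => q.2.2.2 :=
      Primrec.snd.comp (Primrec.snd.comp Primrec.snd)
    exact (Primrec.nat_add.comp (Primrec.nat_mul.comp h1 h3) (Primrec.nat_mul.comp h2 h4)).pair
      (Primrec.nat_add.comp (Primrec.nat_mul.comp h1 h4) (Primrec.nat_mul.comp h2 h3))
  · have h1 : Primrec fun q : P × Unit × (ℕ × ℕ) × ℕ × ℕ => q.2.2.1 :=
      Primrec.fst.comp (Primrec.snd.comp Primrec.snd)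
    have h2 : Primrec fun q : P × Unit × (ℕ × ℕ) × ℕ × ℕ => q.2.2.2 :=
      Primrec.snd.comp (Primrec.snd.comp Primrec.snd)
    exact (Primrec.nat_add.comp (Primrec.fst.comp h1) (Primrec.fst.comp h2)).pair
      (Primrec.nat_add.comp (Primrec.snd.comp h1) (Primrec.snd.comp h2))
  · exact (Primrec.of_equiv (e := equivSyn)).comp ht

end IntTerm

/-! ### Truth under a finite assignment is primitive recursive. -/

namespace Formula

variable {A T : Type*}

open Classical in
/-- The truth value of a formula as a fold over its syntax tree. -/
theorem fold_eq_true_iff_holds (ev : T → List A) (g : ℕ → ℤ) (φ : Formula A T) :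
    φ.toSyn.fold
      (fun l => Sum.casesOn l (fun q => decide (ev q.1 ∈ q.2.lang)) fun r =>
        Sum.casesOn r (fun q => decide (q.1.eval ev g ≤ q.2.eval ev g))
          fun q => decide (q.1.eval ev g = q.2.eval ev g))
      (fun _ x => !x) (fun b x y => bif b then x || y else x && y) = true ↔
      φ.Holds ev g := by
  induction φ with
  | not φ ih => simp [Holds, toSyn, Syn.fold, ← ih]
  | and φ ψ ihφ ihψ => simp [Holds, toSyn, Syn.fold, ← ihφ, ← ihψ]
  | or φ ψ ihφ ihψ => simp [Holds, toSyn, Syn.fold, ← ihφ, ← ihψ]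
  | _ => simp [Holds, toSyn, Syn.fold]

variable [Primcodable A] [Finite A] [Primcodable T]

theorem primrecPred_mem_lang : PrimrecPred fun q : List A × Regex A => q.1 ∈ q.2.lang := by
  classical
  have := Fintype.ofFinite A
  have hl : ∀ a, a ∈ (Finset.univ : Finset A).toList := by simp
  have hN : Primrec fun q : List A × Regex A => q.1.length :=
    Primrec.list_length.comp Primrec.fst
  have h := (primrec_mem (T := List A)).comp Primrec.fst
    (Regex.primrec_wordsIn ((primrec_wordsUpTo (Finset.univ : Finset A).toList).comp hN) hN
      Primrec.snd)
  exact h.of_eq fun q => Regex.mem_wordsIn hl q.2 le_rfl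

theorem primrecPred_holds {pat : T → Pattern A} (hp : Primrec pat) :
    PrimrecPred fun q : Assignment A × Formula A T =>
      q.2.Holds (fun α => Pattern.eval q.1.word (pat α)) q.1.int := by
  classical
  have hev : Primrec₂ fun (s : Assignment A) (α : T) => Pattern.eval s.word (pat α) :=
    Assignment.primrec_patternEval.comp Primrec.fst (hp.comp Primrec.snd)
  have hI : Primrec₂ fun (s : Assignment A) (t : IntTerm T) =>
      t.evalDiff (fun α => (Pattern.eval s.word (pat α)).length) s.diff :=
    IntTerm.primrec_evalDiff
      (len' := fun (q : Assignment A × IntTerm T) α => (Pattern.eval q.1.word (pat α)).length)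
      (d := fun q => q.1.diff)
      (Primrec.list_length.comp (hev.comp (Primrec.fst.comp Primrec.fst) Primrec.snd))
      (Assignment.primrec_diff.comp (Primrec.fst.comp Primrec.fst) Primrec.snd) Primrec.snd
  have hle : PrimrecPred fun q : Assignment A × IntTerm T × IntTerm T =>
      q.2.1.eval (fun α => Pattern.eval q.1.word (pat α)) q.1.int ≤
        q.2.2.eval (fun α => Pattern.eval q.1.word (pat α)) q.1.int := by
    have h1 := hI.comp (Primrec.fst (α := Assignment A) (β := IntTerm T × IntTerm T))
      (Primrec.fst.comp Primrec.snd)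
    have h2 := hI.comp (Primrec.fst (α := Assignment A) (β := IntTerm T × IntTerm T))
      (Primrec.snd.comp Primrec.snd)
    -- Differences are compared crosswise: `a - b ≤ c - d` becomes `a + d ≤ c + b`.
    refine (Primrec.nat_le.comp (Primrec.nat_add.comp (Primrec.fst.comp h1) (Primrec.snd.comp h2))
      (Primrec.nat_add.comp (Primrec.fst.comp h2) (Primrec.snd.comp h1))).of_eq fun q => ?_
    unfold Assignment.int
    rw [IntTerm.eval_eq_evalDiff, IntTerm.eval_eq_evalDiff]
    omega
  have hle' : PrimrecPred fun q : Assignment A × IntTerm T × IntTerm T =>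
      q.2.2.eval (fun α => Pattern.eval q.1.word (pat α)) q.1.int ≤
        q.2.1.eval (fun α => Pattern.eval q.1.word (pat α)) q.1.int :=
    hle.comp (Primrec.fst.pair
      ((Primrec.snd.comp Primrec.snd).pair (Primrec.fst.comp Primrec.snd)))
  have heq : PrimrecPred fun q : Assignment A × IntTerm T × IntTerm T =>
      q.2.1.eval (fun α => Pattern.eval q.1.word (pat α)) q.1.int =
        q.2.2.eval (fun α => Pattern.eval q.1.word (pat α)) q.1.int :=
    (hle.and hle').of_eq fun q => le_antisymm_iff.symm
  refine (Primrec.eq.comp (Syn.primrec_fold (t := fun q : Assignment A × Formula A T => q.2.toSyn)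
    (f := fun s l => Sum.casesOn l
        (fun q => decide (Pattern.eval s.1.word (pat q.1) ∈ q.2.lang)) fun r =>
        Sum.casesOn r (fun q => decide (q.1.eval (fun α => Pattern.eval s.1.word (pat α)) s.1.int ≤
            q.2.eval (fun α => Pattern.eval s.1.word (pat α)) s.1.int))
          fun q => decide (q.1.eval (fun α => Pattern.eval s.1.word (pat α)) s.1.int =
            q.2.eval (fun α => Pattern.eval s.1.word (pat α)) s.1.int))
    (g := fun _ (q : Unit × Bool) => !q.2)
    (k := fun _ (q : Bool × Bool × Bool) => bif q.1 then q.2.1 || q.2.2 else q.2.1 && q.2.2)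
    ?_ ?_ ?_ ?_) (Primrec.const true)).of_eq fun q => by
      convert fold_eq_true_iff_holds (fun α => Pattern.eval q.1.word (pat α)) q.1.int q.2
  · have h1 : Primrec fun q : (Assignment A × Formula A T) ×
        ((IntTerm T × IntTerm T) ⊕ (IntTerm T × IntTerm T)) => (Sum.casesOn q.2
          (fun r => decide (r.1.eval (fun α => Pattern.eval q.1.1.word (pat α)) q.1.1.int ≤
            r.2.eval (fun α => Pattern.eval q.1.1.word (pat α)) q.1.1.int))
          fun r => decide (r.1.eval (fun α => Pattern.eval q.1.1.word (pat α)) q.1.1.int =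
            r.2.eval (fun α => Pattern.eval q.1.1.word (pat α)) q.1.1.int) : Bool) :=
      Primrec.sumCasesOn Primrec.snd
        (hle.comp ((Primrec.fst.comp (Primrec.fst.comp Primrec.fst)).pair Primrec.snd)).decide.to₂
        (heq.comp ((Primrec.fst.comp (Primrec.fst.comp Primrec.fst)).pair Primrec.snd)).decide.to₂
    exact Primrec.sumCasesOn Primrec.snd
      (primrecPred_mem_lang.comp ((hev.comp (Primrec.fst.comp (Primrec.fst.comp Primrec.fst))
        (Primrec.fst.comp Primrec.snd)).pair (Primrec.snd.comp Primrec.snd))).decide.to₂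
      (h1.comp ((Primrec.fst.comp Primrec.fst).pair Primrec.snd)).to₂
  · exact Primrec.not.comp (Primrec.snd.comp Primrec.snd)
  · have h1 : Primrec fun q : (Assignment A × Formula A T) × Bool × Bool × Bool => q.2.2.1 :=
      Primrec.fst.comp (Primrec.snd.comp Primrec.snd)
    have h2 : Primrec fun q : (Assignment A × Formula A T) × Bool × Bool × Bool => q.2.2.2 :=
      Primrec.snd.comp (Primrec.snd.comp Primrec.snd)
    exact Primrec.cond (Primrec.fst.comp Primrec.snd) (Primrec.or.comp h1 h2)
      (Primrec.and.comp h1 h2)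
  · exact (Primrec.of_equiv (e := equivSyn)).comp Primrec.snd

end Formula


/-! ### Small solutions of linear inequalities. -/

section SmallSolutions

/-- A bound on the binary lengths of small solutions of linear constraints in `k` unknowns with
coefficients of absolute value at most `D`. -/
def solutionBits (k D : ℕ) : ℕ :=
  (2 * ((k + 1) * D) + 1) ^ ((2 * D + 1) ^ (k + 1))

/-- The quantity bounded is the carry at binary position `i`. The digits below `i` contribute at
most `D * 2 ^ i` per unknown, so after division the bound no longer depends on `i`. -/
theorem abs_carry_le {V : Type*} [Fintype V] {D : ℕ} {a : V → ℤ} {b : ℤ}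
    (ha : ∀ v, |a v| ≤ D) (hb : |b| ≤ D) (z : V → ℕ) (i : ℕ) :
    |(-(∑ v, a v * ((z v % 2 ^ i : ℕ) : ℤ) + b)) / 2 ^ i| ≤ (Fintype.card V + 1) * D := by
  have hp : (0 : ℤ) < 2 ^ i := by positivity
  have h1 : |∑ v, a v * ((z v % 2 ^ i : ℕ) : ℤ)| ≤ Fintype.card V * (D * 2 ^ i) := by
    refine (Finset.abs_sum_le_sum_abs _ _).trans ?_
    refine (Finset.sum_le_card_nsmul _ _ ((D : ℤ) * 2 ^ i) fun v _ => ?_).trans_eq (by simp)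
    rw [abs_mul, Nat.abs_cast]
    have : z v % 2 ^ i ≤ 2 ^ i := (Nat.mod_lt _ (by positivity)).le
    have : ((z v % 2 ^ i : ℕ) : ℤ) ≤ 2 ^ i := by exact_mod_cast this
    exact mul_le_mul (ha v) this (by positivity) (by positivity)
  have h2 : |b| ≤ (D : ℤ) * 2 ^ i :=
    hb.trans (le_mul_of_one_le_right (by positivity) (one_le_pow₀ (by norm_num)))
  rw [abs_le] at h1 h2 ⊢
  constructor
  · rw [Int.le_ediv_iff_mul_le hp]
    linarith
  · refine Int.ediv_le_of_le_mul hp ?_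
    linarith

/-- Take a vector with the same truth values as `z` and least sum of entries. If an entry had more
than `solutionBits` binary digits, two positions would have equal carries for all constraints, and
deleting the digits between them would give a smaller such vector. Treating all bounded constraints
simultaneously makes a disjunctive normal form unnecessary. -/
theorem exists_small_solution {V : Type*} [Fintype V] (D : ℕ) (z : V → ℕ) :
    ∃ z' : V → ℕ, (∀ v, z' v < 2 ^ solutionBits (Fintype.card V) D) ∧
      ∀ (a : V → ℤ) (b : ℤ), (∀ v, |a v| ≤ D) → |b| ≤ D →
        (∑ v, a v * z' v + b ≤ 0 ↔ ∑ v, a v * z v + b ≤ 0) := by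
  classical
  let S : Set (V → ℕ) := {z' | ∀ (a : V → ℤ) (b : ℤ), (∀ v, |a v| ≤ D) → |b| ≤ D →
        (∑ v, a v * z' v + b ≤ 0 ↔ ∑ v, a v * z v + b ≤ 0)}
  obtain ⟨y, hy, hmin⟩ := (measure fun z' : V → ℕ => ∑ v, z' v).wf.has_min S
    ⟨z, fun a b _ _ => Iff.rfl⟩
  refine ⟨y, fun v₀ => ?_, hy⟩
  by_contra! hv₀
  set K := solutionBits (Fintype.card V) D with hK
  let E : ℕ := (Fintype.card V + 1) * D
  let co (j : Fin (2 * D + 1)) : ℤ := (j : ℕ) - D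
  let carry (i : ℕ) (a : V → ℤ) (b : ℤ) : ℤ :=
    (-(∑ v, a v * ((y v % 2 ^ i : ℕ) : ℤ) + b)) / 2 ^ i
  have hco (j : Fin (2 * D + 1)) : |co j| ≤ D := by
    have := j.2
    simp only [co, abs_le]
    omega
  have hsurj (c : ℤ) (hc : |c| ≤ D) : ∃ j, co j = c := by
    rw [abs_le] at hc
    exact ⟨⟨(c + D).toNat, by omega⟩, by simp only [co]; omega⟩
  have hcarry (i : ℕ) (a : V → ℤ) (b : ℤ) (ha : ∀ v, |a v| ≤ D) (hb : |b| ≤ D) :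
      |carry i a b| ≤ E := by
    exact_mod_cast abs_carry_le ha hb y i
  -- The state of a position lists its carries for all coefficient vectors; `none` indexes the
  -- constant term and the shift by `E` makes the carry nonnegative. There are exactly `K`
  -- conceivable states for the `K + 1` positions.
  let state (i : Fin (K + 1)) (q : Option V → Fin (2 * D + 1)) : Fin (2 * E + 1) :=
    ⟨(carry i (fun v => co (q (some v))) (co (q none)) + E).toNat, by
      have := hcarry i (fun v => co (q (some v))) (co (q none)) (fun v => hco _) (hco _)
      rw [abs_le] at this
      omega⟩
  have hstate {i j : Fin (K + 1)} (h : state i = state j) (a : V → ℤ) (b : ℤ)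
      (ha : ∀ v, |a v| ≤ D) (hb : |b| ≤ D) : carry i a b = carry j a b := by
    choose q hq using fun v => hsurj (a v) (ha v)
    obtain ⟨r, rfl⟩ := hsurj b hb
    obtain rfl : (fun v => co (q v)) = a := funext hq
    have h1 := hcarry i _ _ ha hb
    have h2 := hcarry j _ _ ha hb
    have h3 := congrArg Fin.val (congrFun h fun o => o.elim r q)
    simp only [state, Option.elim] at h3
    rw [abs_le] at h1 h2
    omega
  have hcard : Fintype.card (Option V → Fin (2 * D + 1)) = (2 * D + 1) ^ (Fintype.card V + 1) := by
    simp
  obtain ⟨i, j, hne, hij⟩ := Fintype.exists_ne_map_eq_of_card_lt state (by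
    rw [Fintype.card_fun, hcard, Fintype.card_fin, Fintype.card_fin]
    exact Nat.lt_succ_self K)
  wlog hlt : i < j generalizing i j
  · exact this j i hne.symm hij.symm (lt_of_le_of_ne (not_lt.1 hlt) hne.symm)
  -- With the digits of `y` below position `k` fixed, an inequality restricts the higher part `x`
  -- only through the carry.
  have hsplit (k : ℕ) (x : V → ℕ) (a : V → ℤ) (b : ℤ) :
      ∑ v, a v * ((x v * 2 ^ k + y v % 2 ^ k : ℕ) : ℤ) + b ≤ 0 ↔
        ∑ v, a v * x v ≤ carry k a b := by
    rw [Int.le_ediv_iff_mul_le (by positivity), Finset.sum_mul]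
    have : ∑ v, a v * ((x v * 2 ^ k + y v % 2 ^ k : ℕ) : ℤ) =
        ∑ v, a v * x v * 2 ^ k + ∑ v, a v * ((y v % 2 ^ k : ℕ) : ℤ) := by
      rw [← Finset.sum_add_distrib]
      refine Finset.sum_congr rfl fun v _ => ?_
      push_cast
      ring
    rw [this]
    constructor <;> intro h <;> linarith
  have hself (k : ℕ) : (fun v => y v / 2 ^ k * 2 ^ k + y v % 2 ^ k) = y :=
    funext fun v => Nat.div_add_mod' _ _
  -- The new vector omits the binary digits at positions `i` to `j - 1` of every entry.
  refine hmin (fun v => y v / 2 ^ (j : ℕ) * 2 ^ (i : ℕ) + y v % 2 ^ (i : ℕ))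
    (fun a b ha hb => ?_) ?_
  · rw [hsplit, hstate hij a b ha hb, ← hsplit, ← hy a b ha hb]
    simp only [Nat.div_add_mod']
  · have hle : 2 ^ (i : ℕ) ≤ 2 ^ (j : ℕ) := Nat.pow_le_pow_right two_pos hlt.le
    change ∑ v, (y v / 2 ^ (j : ℕ) * 2 ^ (i : ℕ) + y v % 2 ^ (i : ℕ)) < ∑ v, y v
    refine Finset.sum_lt_sum (fun v _ => ?_) ⟨v₀, Finset.mem_univ _, ?_⟩
    · conv_rhs => rw [← Nat.div_add_mod' (y v) (2 ^ (i : ℕ))]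
      gcongr
    · conv_rhs => rw [← Nat.div_add_mod' (y v₀) (2 ^ (i : ℕ))]
      gcongr 1
      refine Nat.mul_lt_mul_of_pos_right ?_ (by positivity)
      -- The entry at `v₀` has a nonzero part from position `j` on, so shifting it down is a strict
      -- decrease.
      have h1 : 2 ^ (j : ℕ) ≤ y v₀ := (Nat.pow_le_pow_right two_pos (by omega)).trans hv₀
      have h2 : 2 ^ (j : ℕ) = 2 ^ (i : ℕ) * 2 ^ (j - i : ℕ) := by
        rw [← pow_add]
        congr 1
        omega
      rw [h2, ← Nat.div_div_eq_div_mul]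
      refine Nat.div_lt_self (Nat.div_pos (hle.trans h1) (by positivity)) ?_
      exact Nat.one_lt_two_pow (by omega)

end SmallSolutions


/-! ### Bounds on the number of left quotients of a language. -/

section Index

variable {A : Type*}

/-- The language has at most `k` left quotients. -/
def HasIndexLE (k : ℕ) (L : Language A) : Prop :=
  ∃ f : List A → Fin k, ∀ x y, f x = f y → L.leftQuotient x = L.leftQuotient y

theorem HasIndexLE.of_card_le {X : Type} [Fintype X] {k : ℕ} {L : Language A}
    (hk : Fintype.card X ≤ k) (f : List A → X)
    (hf : ∀ x y, f x = f y → L.leftQuotient x = L.leftQuotient y) : HasIndexLE k L := by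
  obtain ⟨e⟩ : Nonempty (X ↪ Fin k) := Function.Embedding.nonempty_of_card_le (by simpa using hk)
  exact ⟨fun x => e (f x), fun x y h => hf x y (e.injective h)⟩

theorem HasIndexLE.mono {k l : ℕ} {L : Language A} (h : HasIndexLE k L) (hkl : k ≤ l) :
    HasIndexLE l L := by
  obtain ⟨f, hf⟩ := h
  exact .of_card_le (by simpa using hkl) f hf

theorem hasIndexLE_zero : HasIndexLE 1 (0 : Language A) :=
  .of_card_le (X := Unit) (by simp) (fun _ => ()) fun _ _ _ => rfl

theorem hasIndexLE_one : HasIndexLE 2 (1 : Language A) := by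
  refine .of_card_le (X := Prop) (by simp) (fun x => x = []) fun x y h => ?_
  ext z
  simp only [eq_iff_iff] at h
  simp [Language.mem_one, h]

theorem hasIndexLE_singleton (a : A) : HasIndexLE 4 ({[a]} : Language A) := by
  refine .of_card_le (X := Prop × Prop) (by simp) (fun x => (x = [], x = [a])) fun x y h => ?_
  simp only [Prod.mk.injEq, eq_iff_iff] at h
  ext z
  change x ++ z = [a] ↔ y ++ z = [a]
  simp [List.append_eq_singleton_iff, h]

theorem HasIndexLE.compl {k : ℕ} {L : Language A} (h : HasIndexLE k L) : HasIndexLE k Lᶜ := by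
  obtain ⟨f, hf⟩ := h
  exact ⟨f, fun x y hxy => congrArg (fun M : Language A => Mᶜ) (hf x y hxy)⟩

theorem HasIndexLE.add {k l : ℕ} {L M : Language A} (hL : HasIndexLE k L) (hM : HasIndexLE l M) :
    HasIndexLE (k * l) (L + M) := by
  obtain ⟨f, hf⟩ := hL
  obtain ⟨g, hg⟩ := hM
  refine .of_card_le (X := Fin k × Fin l) (by simp) (fun x => (f x, g x)) fun x y h => ?_
  rw [Prod.mk.injEq] at h
  exact congrArg₂ (fun L M : Language A => L + M) (hf x y h.1) (hg x y h.2)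

/-- The boundary between the two factors falls either within `y` or within `x`. -/
theorem append_mem_mul_iff {L M : Language A} {x y : List A} :
    x ++ y ∈ L * M ↔ y ∈ L.leftQuotient x * M ∨
      ∃ x₁ x₂, x₁ ++ x₂ = x ∧ x₁ ∈ L ∧ y ∈ M.leftQuotient x₂ := by
  simp only [Language.mem_mul, Language.mem_leftQuotient]
  constructor
  · rintro ⟨u, hu, v, hv, h⟩
    obtain ⟨s, rfl, rfl⟩ | ⟨s, rfl, rfl⟩ := List.append_eq_append_iff.1 h
    · exact Or.inr ⟨u, s, rfl, hu, hv⟩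
    · exact Or.inl ⟨s, hu, v, hv, rfl⟩
  · rintro (⟨s, hs, v, hv, rfl⟩ | ⟨u, s, rfl, hu, hv⟩)
    · exact ⟨x ++ s, hs, v, hv, by simp⟩
    · exact ⟨u, hu, s ++ y, hv, by simp⟩

/-- This is the subset construction: the quotient by `x` depends only on the class of `x` for `L`
and on the set of classes for `M` of what remains of `x` after a prefix in `L`. -/
theorem HasIndexLE.mul {k l : ℕ} {L M : Language A} (hL : HasIndexLE k L) (hM : HasIndexLE l M) :
    HasIndexLE (k * 2 ^ l) (L * M) := by
  obtain ⟨f, hf⟩ := hL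
  obtain ⟨g, hg⟩ := hM
  refine .of_card_le (X := Fin k × Set (Fin l)) (by simp)
    (fun x => (f x, {c | ∃ x₁ x₂, x₁ ++ x₂ = x ∧ x₁ ∈ L ∧ g x₂ = c})) ?_
  have key (x y : List A) (h : {c | ∃ x₁ x₂, x₁ ++ x₂ = x ∧ x₁ ∈ L ∧ g x₂ = c} ⊆
      {c | ∃ x₁ x₂, x₁ ++ x₂ = y ∧ x₁ ∈ L ∧ g x₂ = c}) (z : List A) :
      (∃ x₁ x₂, x₁ ++ x₂ = x ∧ x₁ ∈ L ∧ z ∈ M.leftQuotient x₂) →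
        ∃ x₁ x₂, x₁ ++ x₂ = y ∧ x₁ ∈ L ∧ z ∈ M.leftQuotient x₂ := by
    rintro ⟨x₁, x₂, hx, hx₁, hz⟩
    obtain ⟨y₁, y₂, hy, hy₁, hg'⟩ := h ⟨x₁, x₂, hx, hx₁, rfl⟩
    exact ⟨y₁, y₂, hy, hy₁, hg _ _ hg' ▸ hz⟩
  intro x y h
  rw [Prod.mk.injEq] at h
  ext z
  rw [Language.mem_leftQuotient, Language.mem_leftQuotient, append_mem_mul_iff,
    append_mem_mul_iff, hf x y h.1]
  exact or_congr_right ⟨key x y h.2.subset z, key y x h.2.symm.subset z⟩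

/-- Either the cut after `x` is a boundary between factors, which includes the empty product, or it
lies in a factor whose part in `x` is `x₂`. -/
theorem append_mem_kstar_iff {L : Language A} {x y : List A} :
    x ++ y ∈ KStar.kstar L ↔ (x ∈ KStar.kstar L ∧ y ∈ KStar.kstar L) ∨
      ∃ x₁ x₂, x₁ ++ x₂ = x ∧ x₁ ∈ KStar.kstar L ∧ y ∈ L.leftQuotient x₂ * KStar.kstar L := by
  have cons {u v : List A} (hu : u ∈ L) (hv : v ∈ KStar.kstar L) : u ++ v ∈ KStar.kstar L := by
    rw [← Language.one_add_self_mul_kstar_eq_kstar]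
    exact Or.inr ⟨u, hu, v, hv, rfl⟩
  have app {u v : List A} (hu : u ∈ KStar.kstar L) (hv : v ∈ KStar.kstar L) :
      u ++ v ∈ KStar.kstar L := by
    rw [← kstar_mul_kstar]
    exact ⟨u, hu, v, hv, rfl⟩
  constructor
  · intro h
    obtain ⟨S, hxy, hS⟩ := Language.mem_kstar.1 h
    clear h
    induction S generalizing x with
    | nil =>
      obtain ⟨rfl, rfl⟩ := List.append_eq_nil_iff.1 hxy
      exact Or.inl ⟨Language.nil_mem_kstar _, Language.nil_mem_kstar _⟩
    | cons s S ih =>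
      have hs := hS s (by simp)
      have hS' : ∀ t ∈ S, t ∈ L := fun t ht => hS t (by simp [ht])
      rw [List.flatten_cons] at hxy
      obtain ⟨r, rfl, rfl⟩ | ⟨r, rfl, hr⟩ := List.append_eq_append_iff.1 hxy
      · exact Or.inr ⟨[], x, rfl, Language.nil_mem_kstar _, r, hs, _,
          Language.join_mem_kstar hS', rfl⟩
      · obtain ⟨h₁, h₂⟩ | ⟨x₁, x₂, rfl, h₁, h₂⟩ := ih hr.symm hS'
        · exact Or.inl ⟨cons hs h₁, h₂⟩
        · exact Or.inr ⟨s ++ x₁, x₂, by simp, cons hs h₁, h₂⟩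
  · rintro (⟨hx, hy⟩ | ⟨x₁, x₂, rfl, h₁, u, hu, v, hv, rfl⟩)
    · exact app hx hy
    · have := app h₁ (cons hu hv)
      simpa using this

theorem HasIndexLE.kstar {k : ℕ} {L : Language A} (hL : HasIndexLE k L) :
    HasIndexLE (2 * 2 ^ k) (KStar.kstar L) := by
  obtain ⟨f, hf⟩ := hL
  refine .of_card_le (X := Prop × Set (Fin k)) (by simp)
    (fun x => (x ∈ KStar.kstar L, {c | ∃ x₁ x₂, x₁ ++ x₂ = x ∧ x₁ ∈ KStar.kstar L ∧ f x₂ = c})) ?_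
  have key (x y : List A) (h : {c | ∃ x₁ x₂, x₁ ++ x₂ = x ∧ x₁ ∈ KStar.kstar L ∧ f x₂ = c} ⊆
      {c | ∃ x₁ x₂, x₁ ++ x₂ = y ∧ x₁ ∈ KStar.kstar L ∧ f x₂ = c}) (z : List A) :
      (∃ x₁ x₂, x₁ ++ x₂ = x ∧ x₁ ∈ KStar.kstar L ∧ z ∈ L.leftQuotient x₂ * KStar.kstar L) →
        ∃ x₁ x₂, x₁ ++ x₂ = y ∧ x₁ ∈ KStar.kstar L ∧ z ∈ L.leftQuotient x₂ * KStar.kstar L := by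
    rintro ⟨x₁, x₂, hx, hx₁, hz⟩
    obtain ⟨y₁, y₂, hy, hy₁, hg'⟩ := h ⟨x₁, x₂, hx, hx₁, rfl⟩
    exact ⟨y₁, y₂, hy, hy₁, hf _ _ hg' ▸ hz⟩
  intro x y h
  rw [Prod.mk.injEq, eq_iff_iff] at h
  ext z
  rw [Language.mem_leftQuotient, Language.mem_leftQuotient, append_mem_kstar_iff,
    append_mem_kstar_iff, h.1]
  exact or_congr_right ⟨key x y h.2.subset z, key y x h.2.symm.subset z⟩

/-- A tower of exponentials that bounds the indices of languages of regular expressions with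
complement. -/
def indexBound : ℕ → ℕ
  | 0 => 4
  | n + 1 => indexBound n * 2 ^ indexBound n

theorem indexBound_mono : Monotone indexBound :=
  monotone_nat_of_le_succ fun _ => Nat.le_mul_of_pos_right _ (by positivity)

theorem four_le_indexBound (n : ℕ) : 4 ≤ indexBound n := indexBound_mono n.zero_le

theorem mul_two_pow_indexBound_le {m n : ℕ} (h : m < n) :
    indexBound m * 2 ^ indexBound m ≤ indexBound n :=
  indexBound_mono (Nat.succ_le_of_lt h)

theorem Syn.lt_toNat_un {L U B : Type*} [Primcodable L] [Primcodable U] [Primcodable B]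
    (u : U) (t : Syn L U B) : encode u + t.toNat < (Syn.un u t).toNat := by
  have h1 := Nat.add_le_pair 1 (Nat.pair (encode u) t.toNat)
  have h2 := Nat.add_le_pair (encode u) t.toNat
  simp only [toNat]
  omega

theorem Syn.lt_toNat_bin {L U B : Type*} [Primcodable L] [Primcodable U] [Primcodable B]
    (b : B) (s t : Syn L U B) : s.toNat + t.toNat < (Syn.bin b s t).toNat := by
  have h1 := Nat.add_le_pair 2 (Nat.pair (encode b) (Nat.pair s.toNat t.toNat))
  have h2 := Nat.add_le_pair (encode b) (Nat.pair s.toNat t.toNat)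
  have h3 := Nat.add_le_pair s.toNat t.toNat
  simp only [toNat]
  omega

theorem Syn.encode_le_toNat_leaf {L U B : Type*} [Primcodable L] [Primcodable U] [Primcodable B]
    (l : L) : encode l ≤ (Syn.leaf l : Syn L U B).toNat :=
  Nat.right_le_pair _ _

/-- Each operation costs at most one step `x ↦ x * 2 ^ x` of the tower, and the code of an
expression exceeds the codes of its parts. Only this bound is needed; no automaton is constructed.
-/
theorem Regex.hasIndexLE_lang [Primcodable A] (R : Regex A) :
    HasIndexLE (indexBound (encode R)) R.lang := by
  change HasIndexLE (indexBound R.toSyn.toNat) R.lang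
  induction R with
  | empty => exact hasIndexLE_zero.mono (le_trans (by norm_num) (four_le_indexBound _))
  | epsilon => exact hasIndexLE_one.mono (le_trans (by norm_num) (four_le_indexBound _))
  | letter a => exact (hasIndexLE_singleton a).mono (four_le_indexBound _)
  | concat R S ihR ihS =>
    have h := Syn.lt_toNat_bin false R.toSyn S.toSyn
    refine HasIndexLE.mono ?_
      (mul_two_pow_indexBound_le (m := max R.toSyn.toNat S.toSyn.toNat) (by simp only [toSyn]; omega))
    exact (ihR.mono (indexBound_mono (le_max_left _ _))).mul
      (ihS.mono (indexBound_mono (le_max_right _ _)))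
  | union R S ihR ihS =>
    have h := Syn.lt_toNat_bin true R.toSyn S.toSyn
    refine HasIndexLE.mono ?_ ((Nat.mul_le_mul_left _ Nat.lt_two_pow_self.le).trans
      (mul_two_pow_indexBound_le (m := max R.toSyn.toNat S.toSyn.toNat)
        (by simp only [toSyn]; omega)))
    exact (ihR.mono (indexBound_mono (le_max_left _ _))).add
      (ihS.mono (indexBound_mono (le_max_right _ _)))
  | star R ih =>
    have h := Syn.lt_toNat_un false R.toSyn
    refine ih.kstar.mono ((Nat.mul_le_mul_right _ ?_).trans
      (mul_two_pow_indexBound_le (m := R.toSyn.toNat) (by simp only [toSyn]; omega)))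
    exact le_trans (by norm_num) (four_le_indexBound _)
  | compl R ih =>
    have h := Syn.lt_toNat_un true R.toSyn
    exact ih.compl.mono (indexBound_mono (by simp only [toSyn]; omega))

end Index

/-! ### Twin words and the periodicity of their lengths. -/

section Twin

variable {A : Type*} [Primcodable A]

/-- Two words are `n`-twins if no expression with code at most `n` separates them in any context. -/
def Twin (n : ℕ) (w w' : List A) : Prop :=
  ∀ R : Regex A, encode R ≤ n → ∀ u, R.lang.leftQuotient (u ++ w) = R.lang.leftQuotient (u ++ w')

variable {n : ℕ} {u u' v v' w w' : List A}

theorem Twin.refl (w : List A) : Twin n w w := fun _ _ _ => rfl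

theorem Twin.trans (h : Twin n u v) (h' : Twin n v w) : Twin n u w :=
  fun R hR x => (h R hR x).trans (h' R hR x)

/-- Left contexts are built into the definition and right contexts are absorbed by the left
quotient, so being twins is a congruence. -/
theorem Twin.append (h : Twin n u u') (h' : Twin n v v') : Twin n (u ++ v) (u' ++ v') := by
  intro R hR x
  rw [← List.append_assoc, ← List.append_assoc, Language.leftQuotient_append, h R hR x,
    ← Language.leftQuotient_append, h' R hR]

theorem Twin.mem_iff (h : Twin n w w') {R : Regex A} (hR : encode R ≤ n) :
    w ∈ R.lang ↔ w' ∈ R.lang := by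
  have := Set.ext_iff.1 (h R hR []) []
  simpa [Language.leftQuotient] using this

theorem Twin.patternEval {h h' : ℕ → List A} {α : Pattern A}
    (hh : ∀ i, Sum.inr i ∈ α → Twin n (h i) (h' i)) :
    Twin n (Pattern.eval h α) (Pattern.eval h' α) := by
  induction α with
  | nil => exact Twin.refl _
  | cons x α ih =>
    refine Twin.append ?_ (ih fun i hi => hh i (List.mem_cons_of_mem _ hi))
    cases x with
    | inl a => exact Twin.refl _
    | inr i => exact hh i (by simp)

/-- The invariant is the transformation that `w` induces on the quotient classes of every expression
of code at most `n`, in the manner of a transition monoid. -/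
theorem exists_twin_invariant (A : Type*) [Primcodable A] (n : ℕ) :
    ∃ g : List A → Fin (n + 1) → Fin (indexBound n) → Fin (indexBound n),
      ∀ w w', g w = g w' → Twin n w w' := by
  classical
  -- Numbers that code no expression are given the empty language.
  have hk (r : Fin (n + 1)) : HasIndexLE (indexBound n)
      ((decode₂ (Regex A) (r : ℕ)).elim 0 Regex.lang) := by
    cases h : decode₂ (Regex A) (r : ℕ) with
    | none => exact hasIndexLE_zero.mono (le_trans (by norm_num) (four_le_indexBound _))
    | some R =>
      refine R.hasIndexLE_lang.mono (indexBound_mono ?_)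
      have := decode₂_eq_some.1 h
      omega
  choose f hf using hk
  -- A class `s` is moved by appending `w` to a chosen representative; the value at labels that are
  -- not attained is immaterial.
  refine ⟨fun w r s => if h : ∃ u, f r u = s then f r (h.choose ++ w) else s,
    fun w w' hw R hR u => ?_⟩
  have hd : decode₂ (Regex A) (encode R) = some R := encodek₂ R
  let r : Fin (n + 1) := ⟨encode R, by omega⟩
  have hex : ∃ v, f r v = f r u := ⟨u, rfl⟩
  have h1 := congrFun (congrFun hw r) (f r u)
  simp only [dif_pos hex] at h1
  have h2 := hf r _ _ h1
  have h3 := hf r _ _ hex.choose_spec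
  simp only [r, hd, Option.elim_some] at h2 h3
  rw [Language.leftQuotient_append, Language.leftQuotient_append, h3] at h2
  rw [Language.leftQuotient_append, Language.leftQuotient_append, h2]

/-- Every word of length `i` has an `n`-twin of length `j`. -/
def LengthTwin (A : Type*) [Primcodable A] (n i j : ℕ) : Prop :=
  ∀ w : List A, w.length = i → ∃ w' : List A, w'.length = j ∧ Twin n w w'

/-- Exchange the prefix of length `i` and keep the rest. -/
theorem LengthTwin.add {i j : ℕ} (h : LengthTwin A n i j) (t : ℕ) :
    LengthTwin A n (i + t) (j + t) := by
  intro w hw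
  obtain ⟨v, hv, hvw⟩ := h (w.take i) (by simp [hw])
  refine ⟨v ++ w.drop i, by simp [hw, hv], ?_⟩
  conv => arg 2; rw [← List.take_append_drop i w]
  exact hvw.append (Twin.refl _)

theorem LengthTwin.add_mul {i p : ℕ} (h : LengthTwin A n i (i + p)) (t k : ℕ) :
    LengthTwin A n (i + t) (i + t + p * k) := by
  induction k with
  | zero => exact fun w hw => ⟨w, hw, Twin.refl w⟩
  | succ k ih =>
    intro w hw
    obtain ⟨v, hv, hwv⟩ := ih w hw
    obtain ⟨x, hx, hvx⟩ := h.add (t + p * k) v (by rw [hv]; ring)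
    exact ⟨x, by rw [hx]; ring, hwv.trans hvx⟩

theorem LengthTwin.sub_mul {i p : ℕ} (h : LengthTwin A n (i + p) i) (t k : ℕ) :
    LengthTwin A n (i + t + p * k) (i + t) := by
  induction k with
  | zero => exact fun w hw => ⟨w, hw, Twin.refl w⟩
  | succ k ih =>
    intro w hw
    obtain ⟨x, hx, hvx⟩ := h.add (t + p * k) w (by rw [hw]; ring)
    obtain ⟨v, hv, hwv⟩ := ih x (by rw [hx]; ring)
    exact ⟨v, hv, hvx.trans hwv⟩

/-- A bound on the preperiods and periods of the sets of lengths of classes of `n`-twins. -/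
def periodBound (n : ℕ) : ℕ := 2 ^ (indexBound n ^ (indexBound n * (n + 1)))

/-- Pigeonhole on the set of invariants realised at each length: there are at most `periodBound n`
such sets and one more length. Two lengths with the same set are twins in both directions, which
gives one preperiod and period for all classes. -/
theorem exists_period (A : Type*) [Primcodable A] (n : ℕ) :
    ∃ i p, 0 < p ∧ i + p ≤ periodBound n ∧ LengthTwin A n i (i + p) ∧
      LengthTwin A n (i + p) i := by
  obtain ⟨g, hg⟩ := exists_twin_invariant A n
  let S (i : Fin (periodBound n + 1)) :
      Set (Fin (n + 1) → Fin (indexBound n) → Fin (indexBound n)) :=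
    {c | ∃ w : List A, w.length = i ∧ g w = c}
  have hS {i j : Fin (periodBound n + 1)} (h : S i ⊆ S j) : LengthTwin A n i j := by
    intro w hw
    obtain ⟨w', hw', hgw⟩ := h ⟨w, hw, rfl⟩
    exact ⟨w', hw', hg _ _ hgw.symm⟩
  obtain ⟨i, j, hne, hij⟩ := Fintype.exists_ne_map_eq_of_card_lt S (by
    rw [Fintype.card_fin]
    simp [periodBound, ← pow_mul])
  wlog hlt : i < j generalizing i j
  · exact this j i hne.symm hij.symm (lt_of_le_of_ne (not_lt.1 hlt) hne.symm)
  have hij' : (i : ℕ) + (j - i) = j := by omega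
  refine ⟨i, j - i, by omega, by omega, ?_, ?_⟩
  · rw [hij']; exact hS hij.subset
  · rw [hij']; exact hS hij.symm.subset

/-- This replaces a word by a natural unknown `y`: any other value of `y` is also the parameter of a
twin. -/
theorem exists_twins_of_lengths (n : ℕ) (w : List A) :
    ∃ r q y : ℕ, r ≤ periodBound n ∧ q ≤ periodBound n ∧ w.length = r + q * y ∧
      ∀ y', ∃ w' : List A, w'.length = r + q * y' ∧ Twin n w w' := by
  obtain ⟨i, p, hp, hip, h₁, h₂⟩ := exists_period A n
  rcases lt_or_ge w.length i with hw | hw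
  -- A word below the preperiod is kept, with `q = 0`.
  · exact ⟨w.length, 0, 0, by omega, by omega, by simp, fun _ => ⟨w, by simp, Twin.refl w⟩⟩
  · have hlt := Nat.mod_lt (w.length - i) hp
    have hlen : w.length = i + (w.length - i) % p + p * ((w.length - i) / p) := by
      have := Nat.mod_add_div (w.length - i) p
      omega
    refine ⟨i + (w.length - i) % p, p, (w.length - i) / p, by omega, by omega, hlen, fun y' => ?_⟩
    -- All full periods are removed, then `y'` of them are inserted.
    obtain ⟨v, hv, hwv⟩ := h₂.sub_mul _ _ w hlen
    obtain ⟨x, hx, hvx⟩ := h₁.add_mul _ y' v hv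
    exact ⟨x, hx, hwv.trans hvx⟩

end Twin


/-! ### Linear forms, transfer of truth and bounded assignments. -/

section LinearForms

variable {A T : Type*}

/-- The values of the first `n + 1` integer variables and the lengths of the values of the first
`n + 1` string variables. -/
def numVal (n : ℕ) (h : ℕ → List A) (g : ℕ → ℤ) : Fin (n + 1) ⊕ Fin (n + 1) → ℤ :=
  Sum.elim (fun i => (h i).length) fun i => g i

theorem Pattern.exists_length_linear {n : ℕ} {α : Pattern A} (hα : ∀ i, Sum.inr i ∈ α → i ≤ n) :
    ∃ (a : Fin (n + 1) ⊕ Fin (n + 1) → ℤ) (b : ℤ), (∀ v, |a v| ≤ α.length) ∧ |b| ≤ α.length ∧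
      ∀ (h : ℕ → List A) (g : ℕ → ℤ),
        ((Pattern.eval h α).length : ℤ) = ∑ v, a v * numVal n h g v + b := by
  induction α with
  | nil => exact ⟨0, 0, by simp, by simp, by simp [Pattern.eval]⟩
  | cons x α ih =>
    obtain ⟨a, b, ha, hb, hab⟩ := ih fun i hi => hα i (List.mem_cons_of_mem _ hi)
    have hcons (h : ℕ → List A) : ((Pattern.eval h (x :: α)).length : ℤ) =
        ((Sum.elim (fun a => [a]) h x).length : ℤ) + (Pattern.eval h α).length := by
      simp [Pattern.eval]
    cases x with
    | inl c =>
      refine ⟨a, b + 1, fun v => (ha v).trans (by simp), ?_, fun h g => ?_⟩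
      · refine (abs_add_le b 1).trans ?_
        simpa using hb
      · rw [hcons, hab h g]
        simp only [Sum.elim_inl, List.length_singleton]
        push_cast
        ring
    | inr i =>
      have hi : i ≤ n := hα i (by simp)
      let w : Fin (n + 1) ⊕ Fin (n + 1) := Sum.inl ⟨i, by omega⟩
      refine ⟨a + Pi.single w 1, b, fun v => ?_, hb.trans (by simp), fun h g => ?_⟩
      · have hs : |(Pi.single w 1 : Fin (n + 1) ⊕ Fin (n + 1) → ℤ) v| ≤ 1 := by
          by_cases hv : v = w
          · subst hv; simp
          · simp [hv]
        refine (abs_add_le _ _).trans ?_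
        push_cast [List.length_cons]
        exact add_le_add (ha v) hs
      · rw [hcons, hab h g]
        have hsum : ∑ v, (Pi.single w 1 : Fin (n + 1) ⊕ Fin (n + 1) → ℤ) v * numVal n h g v =
            (h i).length := by
          rw [Finset.sum_eq_single w (fun v _ hv => by simp [hv]) (by simp)]
          simp [w, numVal]
        simp only [Pi.add_apply, add_mul, Finset.sum_add_distrib, hsum, Sum.elim_inr]
        ring

variable [Primcodable T]

/-- String terms of type `T` are interpreted by patterns whose lengths and variables are bounded by
the codes of the terms. -/
structure IsTermPattern (pat : T → Pattern A) : Prop where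
  length_le : ∀ t, (pat t).length ≤ encode t
  var_le : ∀ t i, Sum.inr i ∈ pat t → i ≤ encode t

variable {pat : T → Pattern A}

/-- The variables of a term have indices at most its code, so `n + 1` of each sort suffice. The
exponential bound is inductive because the code of a compound term exceeds the sum of the codes of
its parts. -/
theorem IntTerm.exists_linear (hp : IsTermPattern pat) {n : ℕ} (t : IntTerm T)
    (ht : encode t ≤ n) :
    ∃ (a : Fin (n + 1) ⊕ Fin (n + 1) → ℤ) (b : ℤ), (∀ v, |a v| ≤ 2 ^ encode t) ∧
      |b| ≤ 2 ^ encode t ∧ ∀ (h : ℕ → List A) (g : ℕ → ℤ),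
        t.eval (fun α => Pattern.eval h (pat α)) g = ∑ v, a v * numVal n h g v + b := by
  change t.toSyn.toNat ≤ n at ht
  change ∃ (a : Fin (n + 1) ⊕ Fin (n + 1) → ℤ) (b : ℤ), (∀ v, |a v| ≤ 2 ^ t.toSyn.toNat) ∧
      |b| ≤ 2 ^ t.toSyn.toNat ∧ ∀ (h : ℕ → List A) (g : ℕ → ℤ),
        t.eval (fun α => Pattern.eval h (pat α)) g = ∑ v, a v * numVal n h g v + b
  have self_le {m k : ℕ} (h : m ≤ k) : (m : ℤ) ≤ 2 ^ k := by
    exact_mod_cast h.trans Nat.lt_two_pow_self.le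
  have one_le (k : ℕ) : (1 : ℤ) ≤ 2 ^ k := one_le_pow₀ (by norm_num)
  induction t with
  | const c =>
    refine ⟨0, c, by simp, ?_, by simp [eval]⟩
    have h1 : encode (Sum.inl c : ℤ ⊕ ℕ ⊕ T) ≤ _ :=
      Syn.encode_le_toNat_leaf (U := ℤ) (B := Unit) (Sum.inl c : ℤ ⊕ ℕ ⊕ T)
    rw [encode_inl] at h1
    have h2 := natAbs_le_encode c
    rw [Int.abs_eq_natAbs]
    exact self_le (by simp only [toSyn]; omega)
  | var i =>
    have h1 : encode (Sum.inr (Sum.inl i) : ℤ ⊕ ℕ ⊕ T) ≤ _ :=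
      Syn.encode_le_toNat_leaf (U := ℤ) (B := Unit) (Sum.inr (Sum.inl i) : ℤ ⊕ ℕ ⊕ T)
    rw [encode_inr, encode_inl, encode_nat] at h1
    simp only [toSyn] at ht ⊢
    let w : Fin (n + 1) ⊕ Fin (n + 1) := Sum.inr ⟨i, by omega⟩
    refine ⟨Pi.single w 1, 0, fun v => ?_, by simp, fun h g => ?_⟩
    · by_cases hv : v = w
      · subst hv; simp [one_le]
      · simp [hv]
    · rw [Finset.sum_eq_single w (fun v _ hv => by simp [hv]) (by simp)]
      simp [w, numVal, eval]
  | len α =>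
    have h1 : encode (Sum.inr (Sum.inr α) : ℤ ⊕ ℕ ⊕ T) ≤ _ :=
      Syn.encode_le_toNat_leaf (U := ℤ) (B := Unit) (Sum.inr (Sum.inr α) : ℤ ⊕ ℕ ⊕ T)
    rw [encode_inr, encode_inr] at h1
    simp only [toSyn] at ht ⊢
    obtain ⟨a, b, ha, hb, hab⟩ := Pattern.exists_length_linear (n := n) (α := pat α)
      fun i hi => (hp.var_le α i hi).trans (by omega)
    have hl := hp.length_le α
    exact ⟨a, b, fun v => (ha v).trans (self_le (by omega)), hb.trans (self_le (by omega)), hab⟩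
  | add s t ihs iht =>
    have hlt := Syn.lt_toNat_bin () s.toSyn t.toSyn
    simp only [toSyn] at ht ⊢
    obtain ⟨a, b, ha, hb, hab⟩ := ihs (by omega)
    obtain ⟨a', b', ha', hb', hab'⟩ := iht (by omega)
    have hpow : (2 : ℤ) ^ s.toSyn.toNat + 2 ^ t.toSyn.toNat ≤
        2 ^ (Syn.bin () s.toSyn t.toSyn).toNat := by
      have h1 : (2 : ℤ) ^ s.toSyn.toNat ≤ 2 ^ ((Syn.bin () s.toSyn t.toSyn).toNat - 1) :=
        pow_le_pow_right₀ (by norm_num) (by omega)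
      have h2 : (2 : ℤ) ^ t.toSyn.toNat ≤ 2 ^ ((Syn.bin () s.toSyn t.toSyn).toNat - 1) :=
        pow_le_pow_right₀ (by norm_num) (by omega)
      have h3 : (Syn.bin () s.toSyn t.toSyn).toNat =
        (Syn.bin () s.toSyn t.toSyn).toNat - 1 + 1 := by omega
      rw [h3, pow_succ]
      linarith
    refine ⟨a + a', b + b', fun v => ?_, ?_, fun h g => ?_⟩
    · exact (abs_add_le _ _).trans ((add_le_add (ha v) (ha' v)).trans hpow)
    · exact (abs_add_le _ _).trans ((add_le_add hb hb').trans hpow)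
    · simp only [eval, hab, hab', Pi.add_apply, add_mul, Finset.sum_add_distrib]
      ring
  | smul c t ih =>
    have hlt := Syn.lt_toNat_un c t.toSyn
    simp only [toSyn] at ht ⊢
    obtain ⟨a, b, ha, hb, hab⟩ := ih (by omega)
    have hmul {x : ℤ} (hx : |x| ≤ 2 ^ t.toSyn.toNat) :
        |c * x| ≤ 2 ^ (Syn.un c t.toSyn).toNat := by
      have h1 : |c| ≤ (2 : ℤ) ^ encode c := by
        rw [Int.abs_eq_natAbs]
        exact self_le (natAbs_le_encode c)
      rw [abs_mul]
      refine (mul_le_mul h1 hx (abs_nonneg _) (by positivity)).trans ?_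
      rw [← pow_add]
      exact pow_le_pow_right₀ (by norm_num) hlt.le
    refine ⟨fun v => c * a v, c * b, fun v => hmul (ha v), hmul hb, fun h g => ?_⟩
    simp only [eval, hab, mul_add, Finset.mul_sum, mul_assoc]

theorem IntTerm.eval_le_eval_iff (hp : IsTermPattern pat) {n : ℕ} {h h' : ℕ → List A}
    {g g' : ℕ → ℤ}
    (hlin : ∀ (a : Fin (n + 1) ⊕ Fin (n + 1) → ℤ) (b : ℤ), (∀ v, |a v| ≤ 2 * 2 ^ n) →
      |b| ≤ 2 * 2 ^ n →
        (∑ v, a v * numVal n h g v + b ≤ 0 ↔ ∑ v, a v * numVal n h' g' v + b ≤ 0))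
    {s t : IntTerm T} (hs : encode s ≤ n) (ht : encode t ≤ n) :
    s.eval (fun α => Pattern.eval h (pat α)) g ≤ t.eval (fun α => Pattern.eval h (pat α)) g ↔
      s.eval (fun α => Pattern.eval h' (pat α)) g' ≤
        t.eval (fun α => Pattern.eval h' (pat α)) g' := by
  obtain ⟨a, b, ha, hb, hab⟩ := s.exists_linear hp hs
  obtain ⟨a', b', ha', hb', hab'⟩ := t.exists_linear hp ht
  have hs' : (2 : ℤ) ^ encode s ≤ 2 ^ n := pow_le_pow_right₀ (by norm_num) hs
  have ht' : (2 : ℤ) ^ encode t ≤ 2 ^ n := pow_le_pow_right₀ (by norm_num) ht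
  have key := hlin (fun v => a v - a' v) (b - b')
    (fun v => (abs_sub _ _).trans (by linarith [ha v, ha' v]))
    ((abs_sub _ _).trans (by linarith))
  simp only [sub_mul, Finset.sum_sub_distrib] at key
  rw [hab, hab', hab, hab']
  constructor <;> intro h
  · have := key.1 (by linarith)
    linarith
  · have := key.2 (by linarith)
    linarith

variable [Primcodable A]

/-- Truth depends only on the twin classes of the words and on which bounded linear inequalities
hold. The factor 2 in `2 * 2 ^ n` comes from subtracting the two sides of an atom, and an equality
is a pair of inequalities. -/
theorem Formula.holds_iff_of_twin (hp : IsTermPattern pat) {n : ℕ} {h h' : ℕ → List A}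
    {g g' : ℕ → ℤ} (hw : ∀ i ≤ n, Twin n (h i) (h' i))
    (hlin : ∀ (a : Fin (n + 1) ⊕ Fin (n + 1) → ℤ) (b : ℤ), (∀ v, |a v| ≤ 2 * 2 ^ n) →
      |b| ≤ 2 * 2 ^ n →
        (∑ v, a v * numVal n h g v + b ≤ 0 ↔ ∑ v, a v * numVal n h' g' v + b ≤ 0))
    (φ : Formula A T) (hφ : encode φ ≤ n) :
    φ.Holds (fun α => Pattern.eval h (pat α)) g ↔ φ.Holds (fun α => Pattern.eval h' (pat α)) g' := by
  change φ.toSyn.toNat ≤ n at hφ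
  have leaf_le (l : Atom A T) (hl : (Syn.leaf l : Syn (Atom A T) Unit Bool).toNat ≤ n) :
      encode l ≤ n :=
    (Syn.encode_le_toNat_leaf l).trans hl
  induction φ with
  | mem α R =>
    have h1 := leaf_le _ hφ
    have h2 := Nat.add_le_pair (encode α) (encode R)
    rw [encode_inl, encode_prod_val] at h1
    refine Twin.mem_iff (n := n) (Twin.patternEval fun i hi => hw i ?_) (by omega)
    exact (hp.var_le _ _ hi).trans (by omega)
  | le s t =>
    have h1 := leaf_le _ hφ
    have h2 := Nat.add_le_pair (encode s) (encode t)
    rw [encode_inr, encode_inl, encode_prod_val] at h1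
    exact IntTerm.eval_le_eval_iff hp hlin (by omega) (by omega)
  | eq s t =>
    have h1 := leaf_le _ hφ
    have h2 := Nat.add_le_pair (encode s) (encode t)
    rw [encode_inr, encode_inr, encode_prod_val] at h1
    simp only [Holds, le_antisymm_iff]
    exact and_congr (IntTerm.eval_le_eval_iff hp hlin (by omega) (by omega))
      (IntTerm.eval_le_eval_iff hp hlin (by omega) (by omega))
  | not φ ih =>
    have := Syn.lt_toNat_un () φ.toSyn
    exact not_congr (ih (by simp only [toSyn] at hφ; omega))
  | and φ ψ ihφ ihψ =>
    have := Syn.lt_toNat_bin false φ.toSyn ψ.toSyn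
    simp only [toSyn] at hφ
    exact and_congr (ihφ (by omega)) (ihψ (by omega))
  | or φ ψ ihφ ihψ =>
    have := Syn.lt_toNat_bin true φ.toSyn ψ.toSyn
    simp only [toSyn] at hφ
    exact or_congr (ihφ (by omega)) (ihψ (by omega))

/-- A bound on the coefficients of the linear constraints after the periods of the sets of lengths
have been substituted. -/
def coeffBound (n : ℕ) : ℕ := (2 * n + 3) * (2 * 2 ^ n) * periodBound n

/-- A bound on the lengths and absolute values in a smallest satisfying assignment. -/
def valueBound (n : ℕ) : ℕ :=
  periodBound n + periodBound n * 2 ^ solutionBits (2 * n + 2) (coeffBound n)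

/-- Twin lengths and integers are parametrised by natural unknowns, the unknowns are made small, and
twins of the resulting lengths are chosen. The clause on `h''` and `g''` records that only variables
up to the code of `φ` matter, so finite lists can represent the assignment. -/
theorem Formula.exists_bounded_assignment (hp : IsTermPattern pat) (φ : Formula A T)
    {h : ℕ → List A} {g : ℕ → ℤ} (hφ : φ.Holds (fun α => Pattern.eval h (pat α)) g) :
    ∃ (h' : ℕ → List A) (g' : ℕ → ℤ), (∀ i, (h' i).length ≤ valueBound (encode φ)) ∧
      (∀ i, (g' i).natAbs ≤ valueBound (encode φ)) ∧
      ∀ h'' g'', (∀ i ≤ encode φ, h'' i = h' i) → (∀ i ≤ encode φ, g'' i = g' i) →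
        φ.Holds (fun α => Pattern.eval h'' (pat α)) g'' := by
  set n := encode φ with hn
  set P := periodBound n with hP
  have hP1 : 1 ≤ P := Nat.one_le_two_pow
  choose r q y hr hq hy hw using fun i => exists_twins_of_lengths n (h i)
  -- Every numerical value is `ρ + σ * z` with `z` natural: `r + q * y` for a length, sign times
  -- absolute value for an integer. Only `z` will change.
  let σ : Fin (n + 1) ⊕ Fin (n + 1) → ℤ := Sum.elim (fun i => q i) fun i => (g i).sign
  let ρ : Fin (n + 1) ⊕ Fin (n + 1) → ℤ := Sum.elim (fun i => r i) fun _ => 0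
  let z : Fin (n + 1) ⊕ Fin (n + 1) → ℕ := Sum.elim (fun i => y i) fun i => (g i).natAbs
  have hσ (v) : |σ v| ≤ P := by
    cases v with
    | inl i => simpa [σ] using hq i
    | inr i =>
      refine (?_ : _ ≤ (1 : ℤ)).trans (by exact_mod_cast hP1)
      simp only [σ, Sum.elim_inr]
      rcases Int.sign_trichotomy (g i) with h | h | h <;> simp [h]
  have hρ (v) : |ρ v| ≤ P := by
    cases v with
    | inl i => simpa [ρ] using hr i
    | inr i => simp [ρ]
  obtain ⟨z', hz', hlin⟩ := exists_small_solution (coeffBound n) z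
  have hcard : Fintype.card (Fin (n + 1) ⊕ Fin (n + 1)) = 2 * n + 2 := by
    simp
    ring
  rw [hcard] at hz'
  have hval (v) : numVal n h g v = ρ v + σ v * z v := by
    cases v with
    | inl i => simp [numVal, ρ, σ, z, hy i]
    | inr i =>
      change g i = 0 + (g i).sign * ((g i).natAbs : ℤ)
      rw [zero_add, Int.sign_mul_natAbs]
  have hmul {c m : ℕ} (hc : c ≤ P) (hm : m < 2 ^ solutionBits (2 * n + 2) (coeffBound n)) :
      c * m ≤ P * 2 ^ solutionBits (2 * n + 2) (coeffBound n) := Nat.mul_le_mul hc hm.le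
  choose w hwl hwt using fun i : Fin (n + 1) => hw i (z' (Sum.inl i))
  refine ⟨fun i => if hi : i < n + 1 then w ⟨i, hi⟩ else [],
    fun i => if hi : i < n + 1 then σ (Sum.inr ⟨i, hi⟩) * z' (Sum.inr ⟨i, hi⟩) else 0,
    fun i => ?_, fun i => ?_, fun h'' g'' hh hg => ?_⟩
  · by_cases hi : i < n + 1
    · simp only [hi, dif_pos, hwl]
      exact add_le_add (hr i) (hmul (hq i) (hz' _))
    · simp [hi]
  · by_cases hi : i < n + 1
    · simp only [hi, dif_pos, Int.natAbs_mul, Int.natAbs_natCast]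
      refine le_add_left (hmul ?_ (hz' _))
      have := hσ (Sum.inr ⟨i, hi⟩)
      rw [Int.abs_eq_natAbs] at this
      exact_mod_cast this
    · simp [hi]
  · have hh' (i : Fin (n + 1)) : h'' i = w i := (hh i (by omega)).trans (dif_pos i.2)
    have hg' (i : Fin (n + 1)) : g'' i = σ (Sum.inr i) * z' (Sum.inr i) :=
      (hg i (by omega)).trans (dif_pos i.2)
    have hval' (v) : numVal n h'' g'' v = ρ v + σ v * z' v := by
      cases v with
      | inl i => simp [numVal, hh', ρ, σ, hwl]
      | inr i => simp [numVal, hg', ρ]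
    refine (Formula.holds_iff_of_twin hp (h := h) (g := g) (fun i hi => ?_)
      (fun a b ha hb => ?_) φ hn.ge).1 hφ
    · exact hh' ⟨i, by omega⟩ ▸ hwt ⟨i, by omega⟩
    -- After substitution the constant term consists of `2 * n + 2` products and `b`, whence the
    -- factor `2 * n + 3` in `coeffBound`.
    · have hsubst (x : Fin (n + 1) ⊕ Fin (n + 1) → ℤ) : ∑ v, a v * (ρ v + σ v * x v) + b =
          ∑ v, (a v * σ v) * x v + (∑ v, a v * ρ v + b) := by
        rw [← add_assoc, ← Finset.sum_add_distrib]
        congr 1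
        exact Finset.sum_congr rfl fun v _ => by ring
      simp only [hval, hval', hsubst]
      have hD : ((coeffBound n : ℕ) : ℤ) = (2 * n + 2) * ((2 * 2 ^ n) * P) + (2 * 2 ^ n) * P := by
        simp only [coeffBound]
        push_cast
        ring
      have hCP : (0 : ℤ) ≤ (2 * 2 ^ n) * P := by positivity
      refine (hlin _ _ (fun v => ?_) ?_).symm
      · rw [abs_mul, hD]
        refine (mul_le_mul (ha v) (hσ v) (abs_nonneg _) (by positivity)).trans ?_
        exact le_add_of_nonneg_left (by positivity)
      · rw [hD]
        refine (abs_add_le _ _).trans (add_le_add ?_ ?_)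
        · refine (Finset.abs_sum_le_sum_abs _ _).trans ?_
          refine (Finset.sum_le_card_nsmul _ _ ((2 * 2 ^ n) * P : ℤ) fun v _ => ?_).trans_eq ?_
          · rw [abs_mul]
            exact mul_le_mul (ha v) (hρ v) (abs_nonneg _) (by positivity)
          · rw [Finset.card_univ, hcard, nsmul_eq_mul]
            push_cast
            ring
        · exact hb.trans (le_mul_of_one_le_right (by positivity) (by exact_mod_cast hP1))

end LinearForms


/-! ### Primitive recursive bounds on codes of assignments. -/

section Bounds

theorem pair_le_pair {a b c d : ℕ} (h₁ : a ≤ c) (h₂ : b ≤ d) : Nat.pair a b ≤ Nat.pair c d := by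
  refine le_trans (b := Nat.pair c b) ?_ ?_
  · rcases h₁.eq_or_lt with rfl | h
    · rfl
    · exact (Nat.pair_lt_pair_left b h).le
  · rcases h₂.eq_or_lt with rfl | h
    · rfl
    · exact (Nat.pair_lt_pair_right c h).le

/-- A bound on the codes of lists of length at most `l` whose members have codes at most `K`. -/
def listCodeBound (K l : ℕ) : ℕ :=
  Nat.rec 0 (fun _ E => Nat.pair K E + 1) l

theorem encode_le_listCodeBound {B : Type*} [Encodable B] {K : ℕ} {l : List B} {m : ℕ}
    (hm : l.length ≤ m) (hK : ∀ x ∈ l, encode x ≤ K) : encode l ≤ listCodeBound K m := by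
  induction l generalizing m with
  | nil => simp
  | cons x l ih =>
    cases m with
    | zero => simp at hm
    | succ m =>
      rw [encode_list_cons]
      exact Nat.succ_le_succ (pair_le_pair (hK x (by simp))
        (ih (by simpa using hm) fun y hy => hK y (by simp [hy])))

theorem primrec_listCodeBound : Primrec₂ listCodeBound :=
  Primrec.nat_rec (Primrec.const 0)
    (Primrec.succ.comp (Primrec₂.natPair.comp Primrec.fst (Primrec.snd.comp Primrec.snd))).to₂

/-- A bound on the codes of smallest satisfying assignments of formulae with code `n`, where `K`
bounds the codes of letters. -/
def assignmentBound (K n : ℕ) : ℕ :=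
  Nat.pair (listCodeBound (listCodeBound K (valueBound n)) (n + 1))
    (listCodeBound (Nat.pair (valueBound n) (valueBound n)) (n + 1))

theorem primrec_indexBound : Primrec indexBound := by
  have hpow : Primrec₂ ((· ^ ·) : ℕ → ℕ → ℕ) := Primrec₂.unpaired'.1 Nat.Primrec.pow
  have h : Primrec fun n : ℕ => Nat.rec (motive := fun _ => ℕ) 4 (fun _ x => x * 2 ^ x) n :=
    Primrec.nat_rec₁ _ (Primrec.nat_mul.comp Primrec.snd
      (hpow.comp (Primrec.const 2) Primrec.snd)).to₂
  refine h.of_eq fun n => ?_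
  induction n with
  | zero => rfl
  | succ n ih => simp only [indexBound, ← ih]

theorem primrec_valueBound : Primrec valueBound := by
  have hpow : Primrec₂ ((· ^ ·) : ℕ → ℕ → ℕ) := Primrec₂.unpaired'.1 Nat.Primrec.pow
  have add {f g : ℕ → ℕ} (hf : Primrec f) (hg : Primrec g) : Primrec fun n => f n + g n :=
    Primrec.nat_add.comp hf hg
  have mul {f g : ℕ → ℕ} (hf : Primrec f) (hg : Primrec g) : Primrec fun n => f n * g n :=
    Primrec.nat_mul.comp hf hg
  have pow {f g : ℕ → ℕ} (hf : Primrec f) (hg : Primrec g) : Primrec fun n => f n ^ g n :=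
    hpow.comp hf hg
  have c (k : ℕ) : Primrec fun _ : ℕ => k := Primrec.const k
  have i : Primrec fun n : ℕ => n := Primrec.id
  have hP : Primrec periodBound :=
    pow (c 2) (pow primrec_indexBound (mul primrec_indexBound (add i (c 1))))
  have hC : Primrec coeffBound :=
    mul (mul (add (mul (c 2) i) (c 3)) (mul (c 2) (pow (c 2) i))) hP
  have hk : Primrec fun n : ℕ => 2 * n + 2 + 1 := add (add (mul (c 2) i) (c 2)) (c 1)
  have hS : Primrec fun n => solutionBits (2 * n + 2) (coeffBound n) :=
    pow (add (mul (c 2) (mul hk hC)) (c 1)) (pow (add (mul (c 2) hC) (c 1)) hk)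
  exact add hP (mul hP (pow (c 2) hS))

theorem primrec_assignmentBound (K : ℕ) : Primrec (assignmentBound K) := by
  have hs : Primrec fun n : ℕ => n + 1 := Primrec.succ
  exact Primrec₂.natPair.comp
    (primrec_listCodeBound.comp
      (primrec_listCodeBound.comp (Primrec.const K) primrec_valueBound) hs)
    (primrec_listCodeBound.comp (Primrec₂.natPair.comp primrec_valueBound primrec_valueBound) hs)

end Bounds

/-! ### The decision procedure. -/

section Decision

/-- Simple string terms as patterns. -/
def SimpleTerm.toPattern {A : Type*} : SimpleTerm A → Pattern A :=
  Sum.elim (List.map Sum.inl) fun i => [Sum.inr i]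

theorem SimpleTerm.patternEval_toPattern {A : Type*} (h : ℕ → List A) :
    (fun t : SimpleTerm A => Pattern.eval h t.toPattern) = SimpleTerm.eval h := by
  funext t
  cases t with
  | inl w => simp [Pattern.eval, toPattern, SimpleTerm.eval, List.flatMap_map]
  | inr i => simp [Pattern.eval, toPattern, SimpleTerm.eval]

variable {A T : Type*} [Primcodable A] [Primcodable T] {pat : T → Pattern A}

theorem Formula.exists_assignment_of_holds (hp : IsTermPattern pat) {K : ℕ}
    (hK : ∀ a : A, encode a ≤ K) (φ : Formula A T) {h : ℕ → List A} {g : ℕ → ℤ}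
    (hφ : φ.Holds (fun α => Pattern.eval h (pat α)) g) :
    ∃ s : Assignment A, encode s ≤ assignmentBound K (encode φ) ∧
      φ.Holds (fun α => Pattern.eval s.word (pat α)) s.int := by
  obtain ⟨h', g', hh, hg, hφ'⟩ := φ.exists_bounded_assignment hp hφ
  refine ⟨((List.range (encode φ + 1)).map h',
    (List.range (encode φ + 1)).map fun i => ((g' i).toNat, (-g' i).toNat)), ?_,
    hφ' _ _ (fun i hi => ?_) fun i hi => ?_⟩
  · rw [encode_prod_val]
    refine pair_le_pair (encode_le_listCodeBound (by simp) fun w hw => ?_)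
      (encode_le_listCodeBound (by simp) fun d hd => ?_)
    · obtain ⟨i, -, rfl⟩ := List.mem_map.1 hw
      exact encode_le_listCodeBound (hh i) fun a _ => hK a
    · obtain ⟨i, -, rfl⟩ := List.mem_map.1 hd
      rw [encode_prod_val, encode_nat, encode_nat]
      have := hg i
      exact pair_le_pair (by omega) (by omega)
  · have : i < encode φ + 1 := by omega
    simp [Assignment.word, List.getD, this]
  · have : i < encode φ + 1 := by omega
    simp only [Assignment.int, Assignment.diff, List.getD, List.getElem?_map,
      List.getElem?_range this, Option.map_some, Option.getD_some]
    omega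

/-- Satisfiability is equivalent to an existential quantifier bounded by `assignmentBound`, over a
primitive recursive relation. Finiteness of the alphabet bounds the codes of letters by a constant
`K`. -/
theorem Formula.computablePred_satisfiable [Finite A] (hp : IsTermPattern pat)
    (hpat : Primrec pat) :
    ComputablePred fun φ : Formula A T =>
      ∃ (h : ℕ → List A) (g : ℕ → ℤ), φ.Holds (fun α => Pattern.eval h (pat α)) g := by
  classical
  obtain ⟨K, hK⟩ := (Set.finite_range (encode : A → ℕ)).bddAbove
  -- Numbers that decode to no assignment count as failures.
  have hrel : PrimrecRel fun (k : ℕ) (φ : Formula A T) =>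
      ((decode k : Option (Assignment A)).elim false fun s =>
        decide (φ.Holds (fun α => Pattern.eval s.word (pat α)) s.int)) = true := by
    refine Primrec.eq.comp ((Primrec.option_casesOn
      (o := fun q : ℕ × Formula A T => (decode q.1 : Option (Assignment A)))
      (f := fun _ => false)
      (g := fun q s => decide (q.2.Holds (fun α => Pattern.eval s.word (pat α)) s.int))
      (Primrec.decode.comp Primrec.fst) (Primrec.const false) ?_).of_eq fun q => ?_)
      (Primrec.const true)
    · exact ((primrecPred_holds hpat).comp
        (Primrec.snd.pair (Primrec.snd.comp Primrec.fst))).decide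
    · cases (decode q.1 : Option (Assignment A)) <;> rfl
  refine (((hrel.exists_mem_list.comp
    (Primrec.list_range.comp <| Primrec.succ.comp ((primrec_assignmentBound K).comp Primrec.encode)) Primrec.id).of_eq
    fun φ => ?_).computablePred)
  constructor
  · rintro ⟨k, -, hk⟩
    cases hs : (decode k : Option (Assignment A)) with
    | none => simp [hs] at hk
    | some s => exact ⟨s.word, s.int, by simpa [hs] using hk⟩
  · rintro ⟨h, g, hφ⟩
    obtain ⟨s, hs, hφs⟩ := φ.exists_assignment_of_holds hp (fun a => hK ⟨a, rfl⟩) hφ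
    exact ⟨encode s, List.mem_range.2 (Nat.lt_succ_of_le hs), by simpa using hφs⟩

theorem encode_le_of_mem {B : Type*} [Encodable B] {x : B} {l : List B} (h : x ∈ l) :
    encode x ≤ encode l := by
  induction l with
  | nil => simp at h
  | cons y l ih =>
    rw [encode_list_cons]
    rcases List.mem_cons.1 h with rfl | h
    · exact (Nat.left_le_pair _ _).trans (Nat.le_succ _)
    · exact (ih h).trans ((Nat.right_le_pair _ _).trans (Nat.le_succ _))

theorem isTermPattern_id : IsTermPattern (id : Pattern A → Pattern A) where
  length_le _ := length_le_encode _
  var_le t i h := by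
    have h1 := encode_le_of_mem h
    rw [encode_inr, encode_nat] at h1
    simp only [id] at h1
    omega

theorem SimpleTerm.isTermPattern_toPattern :
    IsTermPattern (toPattern : SimpleTerm A → Pattern A) where
  length_le t := by
    cases t with
    | inl w =>
      have := length_le_encode w
      rw [encode_inl]
      simp only [toPattern, Sum.elim_inl, List.length_map]
      omega
    | inr i =>
      rw [encode_inr]
      simp [toPattern]
  var_le t i h := by
    cases t with
    | inl w => simp [toPattern] at h
    | inr j =>
      obtain rfl : i = j := by simpa [toPattern] using h
      rw [encode_inr, encode_nat]
      omega

theorem SimpleTerm.primrec_toPattern : Primrec (toPattern : SimpleTerm A → Pattern A) := by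
  refine (Primrec.sumCasesOn (f := fun t : SimpleTerm A => t)
    (g := fun _ w => (w.map Sum.inl : Pattern A)) (h := fun _ i => ([Sum.inr i] : Pattern A))
    Primrec.id ?_ ?_).of_eq fun t => ?_
  · exact Primrec.list_map Primrec.snd (Primrec.sumInl.comp Primrec.snd).to₂
  · exact Primrec.list_cons.comp (Primrec.sumInr.comp Primrec.snd) (Primrec.const [])
  · cases t <;> rfl

end Decision

end StrArith

theorem theorem2 (A : Type*) [Finite A] [Primcodable A] :
    ComputablePred (fun φ : StrArith.FormulaELC A => StrArith.FormulaELC.Satisfiable φ) ∧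
      ComputablePred (fun φ : StrArith.FormulaEL A => StrArith.FormulaEL.Satisfiable φ) := by
  refine ⟨StrArith.Formula.computablePred_satisfiable StrArith.isTermPattern_id Primrec.id, ?_⟩
  have h := StrArith.Formula.computablePred_satisfiable
    (StrArith.SimpleTerm.isTermPattern_toPattern (A := A)) StrArith.SimpleTerm.primrec_toPattern
  simp only [StrArith.SimpleTerm.patternEval_toPattern] at h
  exact h
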